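/- Let $A$ be a noetherian commutative ring. Let $\mathsf{D}(\mathsf{Mod}\,A)$ be the derived category of $A$-modules and let $\mathsf{D}^{\mathrm b}_{\mathrm f}(\mathsf{Mod}\,A)$ be its full triangulated subcategory of objects $M$ such that every cohomology module $\mathrm{H}^i(M)$ is finitely generated and $\mathrm{H}^i(M)=0$ for all but finitely many $i$. For an object $R$ with bounded cohomology put $D_R=\mathrm{RHom}_A(-,R)$, a contravariant triangulated functor on $\mathsf{D}(\mathsf{Mod}\,A)$; it is computed by $\mathrm{Hom}_A(-,I)$, where $R\cong I$ is a K-injective resolution. There is a canonical morphism of functors $\theta:\mathrm{id}\to D_R\circ D_R$, induced by the evaluation morphisms $M\to \mathrm{Hom}_A(\mathrm{Hom}_A(M,I),I)$, $m\mapsto(\phi\mapsto(-1)^{kl}\phi(m))$ for $m\in M^k$ and $\phi\in\mathrm{Hom}_A(M,I)^l$. An object $R\in\mathsf{D}^{\mathrm b}_{\mathrm f}(\mathsf{Mod}\,A)$ is called a dualizing complex over $A$ if (i) $R$ has finite injective dimension: there is an integer $i_0$ such that $\mathrm{H}^i(\mathrm{RHom}_A(M,R))=0$ for all $A$-modules $M$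 and all $i>i_0$; and (ii) the canonical morphism $A\to\mathrm{RHom}_A(R,R)$, induced by $A\to\mathrm{Hom}_A(I,I)$, $a\mapsto a\cdot\mathrm{id}_I$, is an isomorphism in $\mathsf{D}(\mathsf{Mod}\,A)$. Theorem. Let $R$ be a dualizing complex over $A$. (1) For every $M\in\mathsf{D}^{\mathrm b}_{\mathrm f}(\mathsf{Mod}\,A)$ the object $D_R(M)$ lies in $\mathsf{D}^{\mathrm b}_{\mathrm f}(\mathsf{Mod}\,A)$, and the canonical morphism $\theta_M:M\to D_R(D_R(M))$ is an isomorphism. (2) The functor $D_R:\mathsf{D}^{\mathrm b}_{\mathrm f}(\mathsf{Mod}\,A)^{\mathrm{op}}\to\mathsf{D}^{\mathrm b}_{\mathrm f}(\mathsf{Mod}\,A)$ is a triangulated functor and an equivalence of categories. -/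

import Mathlib

open CategoryTheory Limits Opposite CochainComplex.HomComplex
open scoped Pretriangulated.Opposite

universe w u

namespace DualizingComplex

noncomputable section

variable {A : Type u} [CommRing A]

/-- Complexes of `A`-modules. -/
abbrev Cplx (A : Type u) [CommRing A] := CochainComplex (ModuleCat.{u} A) ℤ

/-- The complex of `A`-modules `Hom_A(K, I)`: in degree `n` it is the module of families of
`A`-linear maps `K^p ⟶ I^{p + n}`, with differential `φ ↦ φ ≫ d + (-1)^{n + 1} d ≫ φ`. -/
def homComplex (K I : Cplx A) : Cplx A where
  X n := ModuleCat.of A (Cochain K I n)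
  d n m := ModuleCat.ofHom (δ_hom A K I n m)
  shape n m h := by
    refine ModuleCat.hom_ext (LinearMap.ext fun z ↦ ?_)
    exact δ_shape n m h z
  d_comp_d' n₀ n₁ n₂ _ _ := by
    refine ModuleCat.hom_ext (LinearMap.ext fun z ↦ ?_)
    exact δ_δ n₀ n₁ n₂ z

/-- Precomposition with a morphism of complexes `f : K ⟶ L`, as a morphism of complexes
`Hom_A(L, I) ⟶ Hom_A(K, I)`. -/
def homComplexMap {K L : Cplx A} (f : K ⟶ L) (I : Cplx A) :
    homComplex L I ⟶ homComplex K I where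
  f n := ModuleCat.ofHom
    { toFun := fun (z : Cochain L I n) ↦ (Cochain.ofHom f).comp z (zero_add n)
      map_add' := fun z z' ↦ by simp
      map_smul' := fun a z ↦ by simp }
  comm' n m _ := by
    ext z
    exact δ_ofHom_comp f z m

/-- The contravariant functor `Hom_A(-, I)` on complexes. -/
def homComplexFunctor (I : Cplx A) : (Cplx A)ᵒᵖ ⥤ Cplx A where
  obj K := homComplex K.unop I
  map f := homComplexMap f.unop I
  map_id K := by
    ext n z
    exact Cochain.id_comp (z : Cochain K.unop I n)
  map_comp {K L M} f g := by
    ext n z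
    have key (z : Cochain K.unop I n) : (Cochain.ofHom (g.unop ≫ f.unop)).comp z (zero_add n) =
        (Cochain.ofHom g.unop).comp ((Cochain.ofHom f.unop).comp z (zero_add n)) (zero_add n) := by
      rw [Cochain.ofHom_comp, Cochain.comp_assoc_of_first_is_zero_cochain]
    exact key z

/-- The isomorphism `Hom_A(K⟦b⟧, I) ≅ Hom_A(K, I)⟦a⟧` for `a + b = 0`. -/
def homComplexShiftIso (K I : Cplx A) (a b : ℤ) (h : a + b = 0) :
    homComplex (K⟦b⟧) I ≅ (homComplex K I)⟦a⟧ :=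
  HomologicalComplex.Hom.isoOfComponents
    (fun p ↦ (Cochain.leftShiftLinearEquiv A K I (p + a) b p (by lia)).symm.toModuleIso)
    (fun p q _ ↦ by
      obtain rfl : b = -a := by lia
      ext z
      change a.negOnePow • (δ (p + a) (q + a) (Cochain.leftUnshift z (p + a) (by lia))) =
        Cochain.leftUnshift (δ p q z) (q + a) (by lia)
      rw [Cochain.δ_leftUnshift z (p + a) (by lia) (q + a) q (by lia), smul_smul]
      simp)

lemma XIsoOfEq_hom_apply_v (K I : Cplx A) {n n' : ℤ} (h : n = n')
    (z : Cochain K I n) (p q : ℤ) (hpq : p + n' = q) :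
    Cochain.v (((homComplex K I).XIsoOfEq h).hom z : Cochain K I n') p q hpq =
      z.v p q (by lia) := by
  subst h
  rfl

lemma homComplexShiftIso_naturality {K L : Cplx A} (f : K ⟶ L)
    (I : Cplx A) (a b : ℤ) (h : a + b = 0) :
    homComplexMap (f⟦b⟧') I ≫ (homComplexShiftIso K I a b h).hom =
      (homComplexShiftIso L I a b h).hom ≫ (homComplexMap f I)⟦a⟧' := by
  ext p z
  obtain rfl : b = -a := by lia
  have key (z : Cochain (L⟦-a⟧) I p) :
      Cochain.leftUnshift ((Cochain.ofHom (f⟦-a⟧')).comp z (zero_add p)) (p + a) (by lia) =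
        (Cochain.ofHom f).comp (Cochain.leftUnshift z (p + a) (by lia)) (zero_add _) := by
    ext i j hij : 1
    rw [Cochain.leftUnshift_v _ _ _ i j hij (i + a) (by lia), Cochain.zero_cochain_comp_v,
      Cochain.zero_cochain_comp_v,
      Cochain.leftUnshift_v _ _ _ i j hij (i + a) (by lia), Cochain.ofHom_v, Cochain.ofHom_v]
    simp only [CochainComplex.shiftFunctorObjXIso, Linear.comp_units_smul]
    congr 1
    exact (HomologicalComplex.XIsoOfEq_inv_naturality_assoc f _ _).symm
  exact key z

lemma homComplexShiftIso_zero (K I : Cplx A) :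
    (homComplexShiftIso K I 0 0 (add_zero 0)).hom =
      homComplexMap ((shiftFunctorZero (Cplx A) ℤ).inv.app K) I ≫
        (shiftFunctorZero (Cplx A) ℤ).inv.app (homComplex K I) := by
  ext p z
  rw [HomologicalComplex.comp_f, CochainComplex.shiftFunctorZero_inv_app_f]
  refine Cochain.ext _ _ fun i j hij ↦ ?_
  have key (z : Cochain (K⟦(0 : ℤ)⟧) I p) (hij : i + (p + 0) = j) :
      (Cochain.leftUnshift z (p + 0) (by lia)).v i j hij =
    ((Cochain.ofHom ((shiftFunctorZero (Cplx A) ℤ).inv.app K)).comp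
      z (zero_add p)).v i j (by lia) := by
    rw [Cochain.leftUnshift_v _ _ _ i j hij i (by lia), Cochain.zero_cochain_comp_v,
      Cochain.ofHom_v, CochainComplex.shiftFunctorZero_inv_app_f]
    simp [HomologicalComplex.XIsoOfEq]
    rfl
  exact (key z hij).trans (XIsoOfEq_hom_apply_v _ _ _ _ _ _ _).symm

lemma eqToHom_aux {C : Type*} [Category* C] {X Y Z W V : C} (h : X = Y) (h₁ : X = Z)
    (h₂ : W = Z) (h₃ : W = Y) (f : Y ⟶ V) :
    eqToHom h ≫ f = eqToHom h₁ ≫ (eqToIso h₂).inv ≫ eqToHom h₃ ≫ f := by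
  subst h h₁ h₂
  simp

lemma negOnePow_aux (a₁ a₂ p : ℤ) :
    ((-a₁ + -a₂) * p + (-a₁ + -a₂) * (-a₁ + -a₂ - 1) / 2).negOnePow =
      (-a₁ * (p + a₂) + -a₁ * (-a₁ - 1) / 2).negOnePow *
        (-a₂ * p + -a₂ * (-a₂ - 1) / 2).negOnePow := by
  have h (x : ℤ) : ∃ k, -x * (-x - 1) = 2 * k := by
    obtain ⟨k, hk⟩ := Int.even_mul_pred_self (-x)
    exact ⟨k, by lia⟩
  obtain ⟨k₁, hk₁⟩ := h a₁
  obtain ⟨k₂, hk₂⟩ := h a₂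
  have h₃ : (-a₁ + -a₂) * (-a₁ + -a₂ - 1) = 2 * (k₁ + k₂ + a₁ * a₂) := by linarith
  rw [hk₁, hk₂, h₃, ← Int.negOnePow_add]
  simp only [ne_eq, OfNat.ofNat_ne_zero, not_false_eq_true, Int.mul_ediv_cancel_left]
  rw [Int.negOnePow_eq_iff]
  exact ⟨a₁ * a₂, by ring⟩

lemma homComplexShiftIso_add (K I : Cplx A)
    (a₁ a₂ b₁ b₂ b₃ : ℤ) (h₁ : a₁ + b₁ = 0) (h₂ : a₂ + b₂ = 0) (h₃ : a₁ + a₂ + b₃ = 0) :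
    (homComplexShiftIso K I (a₁ + a₂) b₃ h₃).hom =
      homComplexMap ((shiftFunctorAdd' (Cplx A) b₁ b₂ b₃ (by lia)).inv.app K) I ≫
        (homComplexShiftIso (K⟦b₁⟧) I a₂ b₂ h₂).hom ≫
        (homComplexShiftIso K I a₁ b₁ h₁).hom⟦a₂⟧' ≫
        (shiftFunctorAdd (Cplx A) a₁ a₂).inv.app (homComplex K I) := by
  obtain rfl : b₁ = -a₁ := by lia
  obtain rfl : b₂ = -a₂ := by lia
  obtain rfl : b₃ = -a₁ + -a₂ := by lia
  ext p z
  rw [shiftFunctorAdd'_eq_shiftFunctorAdd]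
  refine Cochain.ext _ _ fun i j hij ↦ ?_
  have key (z : Cochain (K⟦-a₁ + -a₂⟧) I p) (hij : i + (p + (a₁ + a₂)) = j) :
      (Cochain.leftUnshift z (p + (a₁ + a₂)) (by lia)).v i j hij =
    (Cochain.leftUnshift (Cochain.leftUnshift
      ((Cochain.ofHom ((shiftFunctorAdd (Cplx A) (-a₁) (-a₂)).inv.app K)).comp
      z (zero_add p)) (p + a₂) (by lia)) (p + a₂ + a₁) (by lia)).v i j (by lia) := by
    rw [Cochain.leftUnshift_v _ _ _ i j hij (i + a₁ + a₂) (by lia),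
      Cochain.leftUnshift_v _ _ _ i j _ (i + a₁) (by lia),
      Cochain.leftUnshift_v _ _ _ (i + a₁) j _ (i + a₁ + a₂) (by lia),
      Cochain.zero_cochain_comp_v,
      Cochain.ofHom_v, CochainComplex.shiftFunctorAdd_inv_app_f]
    rw [Linear.comp_units_smul, smul_smul]
    congr 1
    · exact negOnePow_aux a₁ a₂ p
    · simp [HomologicalComplex.XIsoOfEq]
      exact eqToHom_aux _ _ _ _ _
  exact (key z hij).trans (XIsoOfEq_hom_apply_v _ _ (by lia) _ _ _ _).symm

/-- `Hom_A(K⟦m⟧, I) ≅ Hom_A(K, I)⟦n⟧` for `n + m = 0`, naturally in `K`. -/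
def homComplexFunctorOpShiftIso (I : Cplx A) (n m : ℤ) (h : n + m = 0) :
    (shiftFunctor (Cplx A) m).op ⋙ homComplexFunctor I ≅
      homComplexFunctor I ⋙ shiftFunctor (Cplx A) n :=
  NatIso.ofComponents (fun K ↦ homComplexShiftIso K.unop I n m h)
    (fun f ↦ homComplexShiftIso_naturality f.unop I n m h)

/-- The compatibility of `Hom_A(-, I)` with the shift by `n`: the shift by `n` on the opposite
category is the opposite of the shift by `-n`. -/
def homComplexFunctorShiftIso (I : Cplx A) (n m : ℤ) (h : n + m = 0) :
    shiftFunctor (Cplx A)ᵒᵖ n ⋙ homComplexFunctor I ≅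
      homComplexFunctor I ⋙ shiftFunctor (Cplx A) n :=
  Functor.isoWhiskerRight (Pretriangulated.shiftFunctorOpIso (Cplx A) n m h) _ ≪≫
    homComplexFunctorOpShiftIso I n m h

lemma homComplexFunctorShiftIso_hom_app (I : Cplx A) (n m : ℤ) (h : n + m = 0)
    (K : (Cplx A)ᵒᵖ) :
    (homComplexFunctorShiftIso I n m h).hom.app K =
      (homComplexFunctor I).map ((Pretriangulated.shiftFunctorOpIso (Cplx A) n m h).hom.app K) ≫
        (homComplexFunctorOpShiftIso I n m h).hom.app K := rfl

lemma homComplexFunctorShiftIso_zero (I : Cplx A) (m : ℤ) (h : 0 + m = 0) :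
    homComplexFunctorShiftIso I 0 m h = Functor.CommShift.isoZero (homComplexFunctor I) ℤ := by
  obtain rfl : m = 0 := by lia
  ext1
  ext K : 2
  rw [Functor.CommShift.isoZero_hom_app, Pretriangulated.shiftFunctorZero_op_hom_app,
    homComplexFunctorShiftIso_hom_app, Functor.map_comp, Category.assoc]
  congr 1
  exact homComplexShiftIso_zero K.unop I

lemma homComplexFunctorShiftIso_add (I : Cplx A) (a b : ℤ) :
    homComplexFunctorShiftIso I (a + b) (-(a + b)) (add_neg_cancel _) =
      Functor.CommShift.isoAdd (homComplexFunctorShiftIso I a (-a) (add_neg_cancel _))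
        (homComplexFunctorShiftIso I b (-b) (add_neg_cancel _)) := by
  ext1
  ext K : 2
  rw [Functor.CommShift.isoAdd_hom_app, ← shiftFunctorAdd'_eq_shiftFunctorAdd,
    Pretriangulated.shiftFunctorAdd'_op_hom_app K a b (a + b) rfl (-a) (-b) (-(a + b))
      (by lia) (by lia) (by lia)]
  simp only [homComplexFunctorShiftIso_hom_app]
  have nat := (Pretriangulated.shiftFunctorOpIso (Cplx A) b (-b) (by lia)).hom.naturality
    ((Pretriangulated.shiftFunctorOpIso (Cplx A) a (-a) (by lia)).inv.app K)
  have h₂ := (homComplexFunctorOpShiftIso I b (-b) (by lia)).hom.naturality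
    ((Pretriangulated.shiftFunctorOpIso (Cplx A) a (-a) (by lia)).hom.app K)
  have h₃ : (homComplexFunctorOpShiftIso I (a + b) (-(a + b)) (by lia)).hom.app K =
      (homComplexFunctor I).map
        ((shiftFunctorAdd' (Cplx A) (-a) (-b) (-(a + b)) (by lia)).inv.app K.unop).op ≫
      (homComplexFunctorOpShiftIso I b (-b) (by lia)).hom.app
        ((shiftFunctor (Cplx A) (-a)).op.obj K) ≫
      (shiftFunctor (Cplx A) b).map
        ((homComplexFunctorOpShiftIso I a (-a) (by lia)).hom.app K) ≫
      (shiftFunctorAdd (Cplx A) a b).inv.app ((homComplexFunctor I).obj K) :=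
    homComplexShiftIso_add K.unop I a b (-a) (-b) (-(a + b)) (by lia) (by lia) (by lia)
  rw [Functor.comp_map, Functor.comp_map] at h₂
  rw [h₃]
  simp only [Functor.map_comp, Category.assoc]
  congr 1
  congr 1
  rw [← reassoc_of% h₂, ← Functor.map_comp_assoc, ← Functor.map_comp_assoc,
    ← Functor.map_comp_assoc]
  have cancel : (((Pretriangulated.shiftFunctorOpIso (Cplx A) b (-b) (by lia)).inv.app
        ((shiftFunctor (Cplx A) (-a)).op.obj K) ≫
      (shiftFunctor (Cplx A)ᵒᵖ b).map
        ((Pretriangulated.shiftFunctorOpIso (Cplx A) a (-a) (by lia)).inv.app K)) ≫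
      (Pretriangulated.shiftFunctorOpIso (Cplx A) b (-b) (by lia)).hom.app _) ≫
      (shiftFunctor (Cplx A) (-b)).op.map
        ((Pretriangulated.shiftFunctorOpIso (Cplx A) a (-a) (by lia)).hom.app K) = 𝟙 _ := by
    rw [Category.assoc, Category.assoc, reassoc_of% nat, ← Functor.map_comp,
      Iso.inv_hom_id_app, CategoryTheory.Functor.map_id, Category.comp_id, Iso.inv_hom_id_app]
  have := (homComplexFunctor I).congr_map cancel
  rw [CategoryTheory.Functor.map_id] at this
  exact (Category.id_comp _).symm.trans (congrArg (· ≫ _) this.symm)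

instance homComplexFunctorCommShift (I : Cplx A) :
    (homComplexFunctor I).CommShift ℤ where
  commShiftIso n := homComplexFunctorShiftIso I n (-n) (add_neg_cancel n)
  commShiftIso_zero := homComplexFunctorShiftIso_zero I _ _
  commShiftIso_add a b := homComplexFunctorShiftIso_add I a b

lemma shortComplex_quasiIso_of_elements {S₁ S₂ : ShortComplex (ModuleCat.{u} A)} (φ : S₁ ⟶ S₂)
    (inj : ∀ x : S₁.X₂, S₁.g.hom x = 0 → ∀ y : S₂.X₁, S₂.f.hom y = φ.τ₂.hom x →
      ∃ z : S₁.X₁, S₁.f.hom z = x)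
    (surj : ∀ y : S₂.X₂, S₂.g.hom y = 0 → ∃ (x : S₁.X₂) (z : S₂.X₁),
      S₁.g.hom x = 0 ∧ φ.τ₂.hom x + S₂.f.hom z = y) :
    ShortComplex.QuasiIso φ := by
  let γ : ShortComplex.LeftHomologyMapData φ S₁.moduleCatLeftHomologyData
    S₂.moduleCatLeftHomologyData := default
  let k : LinearMap.ker S₁.g.hom →ₗ[A] LinearMap.ker S₂.g.hom := γ.φK.hom
  let h : (LinearMap.ker S₁.g.hom ⧸ LinearMap.range S₁.moduleCatToCycles) →ₗ[A]
    (LinearMap.ker S₂.g.hom ⧸ LinearMap.range S₂.moduleCatToCycles) := γ.φH.hom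
  have hi (x : LinearMap.ker S₁.g.hom) : (k x : S₂.X₂) = φ.τ₂.hom (x : S₁.X₂) :=
    LinearMap.congr_fun (congrArg ModuleCat.Hom.hom γ.commi) x
  have hπ (x : LinearMap.ker S₁.g.hom) : h (Submodule.Quotient.mk x) =
      Submodule.Quotient.mk (k x) :=
    LinearMap.congr_fun (congrArg ModuleCat.Hom.hom γ.commπ) x
  rw [γ.quasiIso_iff, ConcreteCategory.isIso_iff_bijective]
  change Function.Bijective h
  constructor
  · rw [injective_iff_map_eq_zero]
    intro a ha
    obtain ⟨x, rfl⟩ := Submodule.Quotient.mk_surjective _ a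
    rw [hπ, Submodule.Quotient.mk_eq_zero] at ha
    obtain ⟨y, hy⟩ := ha
    obtain ⟨z, hz⟩ := inj x x.2 y (by rw [← hi, ← hy]; rfl)
    rw [Submodule.Quotient.mk_eq_zero]
    exact ⟨z, Subtype.ext hz⟩
  · intro b
    obtain ⟨y, rfl⟩ := Submodule.Quotient.mk_surjective _ b
    obtain ⟨x, z, hx, hz⟩ := surj y y.2
    refine ⟨Submodule.Quotient.mk ⟨x, hx⟩, (hπ _).trans ?_⟩
    refine ((Submodule.Quotient.eq _).mpr ⟨-z, Subtype.ext ?_⟩)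
    rw [AddSubgroupClass.coe_sub, hi, ← hz, map_neg]
    change - S₂.f.hom z = _
    abel

lemma quasiIso_of_elements {K L : Cplx A} (f : K ⟶ L)
    (inj : ∀ (n m : ℤ) (_ : n + 1 = m) (x : K.X m), (K.d m (m + 1)).hom x = 0 →
      ∀ y : L.X n, (L.d n m).hom y = (f.f m).hom x → ∃ z : K.X n, (K.d n m).hom z = x)
    (surj : ∀ (n m : ℤ) (_ : n + 1 = m) (y : L.X m), (L.d m (m + 1)).hom y = 0 →
      ∃ (x : K.X m) (z : L.X n), (K.d m (m + 1)).hom x = 0 ∧ (f.f m).hom x + (L.d n m).hom z = y) :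
    QuasiIso f where
  quasiIsoAt m := by
    rw [quasiIsoAt_iff' f (m - 1) m (m + 1) (by simp) (by simp)]
    exact shortComplex_quasiIso_of_elements _ (inj _ _ (by lia)) (surj _ _ (by lia))

lemma acyclic_mappingCone {K L : Cplx A} (f : K ⟶ L) (hf : QuasiIso f) :
    (CochainComplex.mappingCone f).Acyclic := by
  rw [← HomotopyCategory.quotient_obj_mem_subcategoryAcyclic_iff_acyclic]
  refine ((HomotopyCategory.subcategoryAcyclic (ModuleCat.{u} A)).trW_iff_of_distinguished _
    (HomotopyCategory.mappingCone_triangleh_distinguished f)).1 ?_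
  rw [← HomotopyCategory.quasiIso_eq_trW_subcategoryAcyclic]
  exact (HomotopyCategory.quotient_map_mem_quasiIso_iff f).2 hf

lemma quasiIso_homComplexMap {K L : Cplx A} (f : K ⟶ L) (hf : QuasiIso f) (I : Cplx A)
    [I.IsKInjective] : QuasiIso (homComplexMap f I) := by
  have hZ := acyclic_mappingCone f hf
  refine quasiIso_of_elements _ ?_ ?_
  · intro n m hnm
    have key (z : Cochain L I m) (hz : δ m (m + 1) z = 0) (α : Cochain K I n)
        (hα : δ n m α = (Cochain.ofHom f).comp z (zero_add m)) :
        ∃ β : Cochain L I n, δ n m β = z := by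
      obtain ⟨η, hη⟩ := CochainComplex.IsKInjective.eq_δ_of_cocycle
        (CochainComplex.mappingCone.descCocycle f (m.negOnePow • α)
          (Cocycle.mk z (m + 1) rfl hz) hnm (by simp [hα])) hZ n hnm
      refine ⟨(Cochain.ofHom (CochainComplex.mappingCone.inr f)).comp η (zero_add n), ?_⟩
      rw [δ_ofHom_comp, hη]
      simp
    exact fun x hx y hy ↦ key x hx y hy
  · intro n m hnm
    have key (y : Cochain K I m) (hy : δ m (m + 1) y = 0) :
        ∃ (x : Cochain L I m) (z : Cochain K I n), δ m (m + 1) x = 0 ∧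
          (Cochain.ofHom f).comp x (zero_add m) + δ n m z = y := by
      obtain ⟨η, hη⟩ := CochainComplex.IsKInjective.eq_δ_of_cocycle
        (CochainComplex.mappingCone.descCocycle f y
          (0 : Cocycle L I (m + 1)) rfl (by simp [hy])) hZ m rfl
      refine ⟨(-m.negOnePow) • (Cochain.ofHom (CochainComplex.mappingCone.inr f)).comp η (zero_add m),
        (CochainComplex.mappingCone.inl f).comp η (by lia), ?_, ?_⟩
      · rw [δ_units_smul, δ_ofHom_comp, hη]
        simp
      · have h₁ : (CochainComplex.mappingCone.inl f).comp
            (δ m (m + 1) η) (show -1 + (m + 1) = m by lia) = y := by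
          rw [hη]; simp
        rw [δ_comp (CochainComplex.mappingCone.inl f) η _ 0 (m + 1) m hnm
          (by lia) (by lia), h₁]
        simp
    exact fun y hy ↦ key y hy

/-- For `m ∈ K^k`, the cochain of degree `k` which sends `φ ∈ Hom_A(K, I)^p` to
`(-1)^{k p} φ(m)`. -/
def evalCochain (K I : Cplx A) (k : ℤ) (m : K.X k) : Cochain (homComplex K I) I k :=
  Cochain.mk fun p q hpq ↦ (k * p).negOnePow • ModuleCat.ofHom
    { toFun := fun (φ : Cochain K I p) ↦ (φ.v k q (by lia)).hom m
      map_add' := fun φ ψ ↦ by simp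
      map_smul' := fun a φ ↦ by simp }

lemma evalCochain_v_apply (K I : Cplx A) (k : ℤ) (m : K.X k) (p q : ℤ) (hpq : p + k = q)
    (φ : Cochain K I p) :
    ((evalCochain K I k m).v p q hpq).hom φ = (k * p).negOnePow • (φ.v k q (by lia)).hom m := by
  rfl

lemma δ_evalCochain (K I : Cplx A) (k l : ℤ) (h : k + 1 = l) (m : K.X k) :
    δ k l (evalCochain K I k m) = evalCochain K I l ((K.d k l).hom m) := by
  ext p q hpq : 1
  obtain ⟨q', rfl⟩ : ∃ q', q = q' + 1 := ⟨q - 1, by lia⟩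
  rw [δ_v k l h _ p (q' + 1) hpq q' (p + 1) (by lia) (by lia)]
  ext φ
  have key (φ : Cochain K I p) :
      (I.d q' (q' + 1)).hom (((evalCochain K I k m).v p q' (by lia)).hom φ) +
        l.negOnePow • ((evalCochain K I k m).v (p + 1) (q' + 1) (by lia)).hom (δ p (p + 1) φ) =
      ((evalCochain K I l ((K.d k l).hom m)).v p (q' + 1) hpq).hom φ := by
    rw [evalCochain_v_apply]
    erw [evalCochain_v_apply]
    rw [evalCochain_v_apply]
    rw [δ_v p (p + 1) rfl φ k (q' + 1) (by lia) q' l (by lia) (by lia)]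
    obtain rfl : l = k + 1 := h.symm
    have e₁ : (k + 1).negOnePow * (k * (p + 1)).negOnePow = -(k * p).negOnePow := by
      rw [← Int.negOnePow_add, ← Int.negOnePow_succ, Int.negOnePow_eq_iff]
      exact ⟨k, by ring⟩
    have e₂ : ((k + 1) * p).negOnePow = -((k * p).negOnePow * (p + 1).negOnePow) := by
      rw [← Int.negOnePow_add, ← Int.negOnePow_succ, Int.negOnePow_eq_iff]
      exact ⟨-1, by ring⟩
    replace e₁ : ((k + 1).negOnePow : ℤ) * (k * (p + 1)).negOnePow = -(k * p).negOnePow := by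
      rw [← Units.val_mul, e₁, Units.val_neg]
    simp only [ModuleCat.hom_add, ModuleCat.hom_comp, LinearMap.add_apply, LinearMap.comp_apply,
      smul_add, smul_smul, e₁, e₂, Units.smul_def, ModuleCat.hom_zsmul, LinearMap.smul_apply,
      map_zsmul, Units.val_neg, Units.val_mul, neg_smul, ← mul_assoc, neg_mul]
    abel
  exact key φ

/-- The evaluation morphism `K ⟶ Hom_A(Hom_A(K, I), I)`, `m ↦ (φ ↦ (-1)^{deg m deg φ} φ(m))`. -/
def evalMap (K I : Cplx A) : K ⟶ homComplex (homComplex K I) I where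
  f k := ModuleCat.ofHom (Y := Cochain (homComplex K I) I k)
    { toFun := evalCochain K I k
      map_add' := fun m m' ↦ by
        ext p q hpq : 1
        ext φ
        have key (φ : Cochain K I p) := by
          exact (congrArg ((k * p).negOnePow • ·) (map_add (φ.v k q (by lia)).hom m m')).trans
            (smul_add _ _ _)
        exact key φ
      map_smul' := fun a m ↦ by
        ext p q hpq : 1
        ext φ
        have key (φ : Cochain K I p) := by
          exact (congrArg ((k * p).negOnePow • ·) (map_smul (φ.v k q (by lia)).hom a m)).trans
            (smul_comm _ _ _)
        exact key φ }
  comm' k l hkl := by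
    ext m
    exact δ_evalCochain K I k l hkl m

/-- The evaluation morphism, as a natural transformation. -/
def evalNatTrans (I : Cplx A) :
    𝟭 (Cplx A) ⟶ (homComplexFunctor I).rightOp ⋙ homComplexFunctor I where
  app K := evalMap K I
  naturality K L f := by
    ext k m
    refine Cochain.ext _ _ fun p q hpq ↦ ?_
    ext φ
    have key (φ : Cochain L I p) :
      ((evalCochain L I k ((f.f k).hom m)).v p q hpq).hom φ =
      ((evalCochain K I k m).v p q hpq).hom ((Cochain.ofHom f).comp φ (zero_add p)) := by
      erw [evalCochain_v_apply, evalCochain_v_apply]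
      rw [Cochain.zero_cochain_comp_v, Cochain.ofHom_v]
      rfl
    have key₂ (φ : Cochain L I p) : ((evalCochain K I k m).v p q hpq).hom
        ((Cochain.ofHom f).comp φ (zero_add p)) =
      (((Cochain.ofHom (homComplexMap f I)).comp
        (evalCochain K I k m) (zero_add k)).v p q hpq).hom φ := by
      rw [Cochain.zero_cochain_comp_v, Cochain.ofHom_v]
      rfl
    exact (key φ).trans (key₂ φ)

variable [HasDerivedCategory.{w} (ModuleCat.{u} A)]

/-- The derived category of `A`-modules. -/
abbrev DCat (A : Type u) [CommRing A] [HasDerivedCategory.{w} (ModuleCat.{u} A)] :=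
  DerivedCategory (ModuleCat.{u} A)

/-- Quasi-isomorphisms of complexes of `A`-modules. -/
abbrev qis (A : Type u) [CommRing A] : MorphismProperty (Cplx A) :=
  HomologicalComplex.quasiIso (ModuleCat.{u} A) (ComplexShape.up ℤ)

lemma homComplexFunctor_inverts (I : Cplx A) [I.IsKInjective] :
    (qis A).op.IsInvertedBy (homComplexFunctor I ⋙ DerivedCategory.Q) := by
  intro K L f hf
  have : QuasiIso ((homComplexFunctor I).map f) := quasiIso_homComplexMap f.unop hf I
  change IsIso (DerivedCategory.Q.map ((homComplexFunctor I).map f))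
  infer_instance

/-- The contravariant functor on the derived category induced by `Hom_A(-, I)`, for `I`
K-injective. -/
def derivedHom (I : Cplx A) [I.IsKInjective] : (DCat A)ᵒᵖ ⥤ DCat A :=
  Localization.lift (homComplexFunctor I ⋙ DerivedCategory.Q) (homComplexFunctor_inverts I)
    DerivedCategory.Q.op

/-- On the image of a complex `K`, the functor `derivedHom I` is computed by `Hom_A(K, I)`. -/
def derivedHomIso (I : Cplx A) [I.IsKInjective] :
    DerivedCategory.Q.op ⋙ derivedHom I ≅ homComplexFunctor I ⋙ DerivedCategory.Q :=
  Localization.fac _ _ _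

instance derivedHomLifting (I : Cplx A) [I.IsKInjective] :
    Localization.Lifting DerivedCategory.Q.op (qis A).op
    (homComplexFunctor I ⋙ DerivedCategory.Q) (derivedHom I) := ⟨derivedHomIso I⟩

instance derivedHomCommShift (I : Cplx A) [I.IsKInjective] : (derivedHom I).CommShift ℤ :=
  Functor.commShiftOfLocalization DerivedCategory.Q.op (qis A).op ℤ
    (homComplexFunctor I ⋙ DerivedCategory.Q) (derivedHom I)

/-- On the image of a complex `K`, applying `derivedHom I` twice is computed by
`Hom_A(Hom_A(K, I), I)`. -/
def derivedHomBidualIso (I : Cplx A) [I.IsKInjective] :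
    DerivedCategory.Q ⋙ (derivedHom I).rightOp ⋙ derivedHom I ≅
      ((homComplexFunctor I).rightOp ⋙ homComplexFunctor I) ⋙ DerivedCategory.Q :=
  NatIso.ofComponents
    (fun K ↦ (derivedHom I).mapIso ((derivedHomIso I).app (op K)).symm.op ≪≫
        (derivedHomIso I).app (op (homComplex K I)))
    (fun {K L} f ↦ by
      have n₁ := (derivedHomIso I).inv.naturality f.op
      have n₂ := (derivedHomIso I).hom.naturality (homComplexMap f I).op
      change (derivedHom I).map ((derivedHom I).map (DerivedCategory.Q.map f).op).op ≫
          (derivedHom I).map ((derivedHomIso I).inv.app (op L)).op ≫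
            (derivedHomIso I).hom.app (op (homComplex L I)) =
        ((derivedHom I).map ((derivedHomIso I).inv.app (op K)).op ≫
          (derivedHomIso I).hom.app (op (homComplex K I))) ≫ _
      refine Eq.trans ?_ (((Category.assoc _ _ _).trans
        (congrArg ((derivedHom I).map ((derivedHomIso I).inv.app (op K)).op ≫ ·) n₂)).trans
          (Category.assoc _ _ _).symm)
      refine (Category.assoc _ _ _).symm.trans ?_
      refine congrArg (· ≫ _) ?_
      refine ((derivedHom I).map_comp _ _).symm.trans
        (Eq.trans ?_ ((derivedHom I).map_comp _ _))
      exact (derivedHom I).congr_map (Quiver.Hom.unop_inj n₁.symm))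

instance derivedHomBidualLifting (I : Cplx A) [I.IsKInjective] :
    Localization.Lifting DerivedCategory.Q (qis A)
    (((homComplexFunctor I).rightOp ⋙ homComplexFunctor I) ⋙ DerivedCategory.Q)
    ((derivedHom I).rightOp ⋙ derivedHom I) := ⟨derivedHomBidualIso I⟩

/-- The biduality morphism on the derived category induced by the evaluation morphisms of
complexes. -/
def derivedHomBiduality (I : Cplx A) [I.IsKInjective] :
    𝟭 (DCat A) ⟶ (derivedHom I).rightOp ⋙ derivedHom I :=
  Localization.liftNatTrans DerivedCategory.Q (qis A) DerivedCategory.Q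
    (((homComplexFunctor I).rightOp ⋙ homComplexFunctor I) ⋙ DerivedCategory.Q) _ _
    (Functor.whiskerRight (evalNatTrans I) DerivedCategory.Q)

/-- The cohomology module `H^i(M)` of an object of the derived category. -/
abbrev cohomology (i : ℤ) (M : DCat A) : ModuleCat.{u} A :=
  (DerivedCategory.homologyFunctor (ModuleCat.{u} A) i).obj M

/-- Objects with bounded cohomology. -/
def Db (A : Type u) [CommRing A] [HasDerivedCategory.{w} (ModuleCat.{u} A)] :
    ObjectProperty (DCat A) :=
  fun M ↦ ∃ a b : ℤ, ∀ i : ℤ, i < a ∨ b < i → IsZero (cohomology i M)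

/-- Objects with bounded cohomology, all of whose cohomology modules are finitely generated. -/
def Dbf (A : Type u) [CommRing A] [HasDerivedCategory.{w} (ModuleCat.{u} A)] :
    ObjectProperty (DCat A) :=
  fun M ↦ Db A M ∧ ∀ i : ℤ, Module.Finite A (cohomology i M)

instance : (Dbf A).IsClosedUnderIsomorphisms where
  of_iso {M N} e h := by
    obtain ⟨⟨a, b, h₁⟩, h₂⟩ := h
    have e' (i : ℤ) : cohomology i M ≅ cohomology i N := (DerivedCategory.homologyFunctor _ i).mapIso e
    exact ⟨⟨a, b, fun i hi ↦ (h₁ i hi).of_iso (e' i).symm⟩, fun i ↦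
      have := h₂ i
      Module.Finite.equiv (e' i).toLinearEquiv⟩

instance : (Dbf A).ContainsZero where
  exists_zero := by
    obtain ⟨Z, hZ⟩ := HasZeroObject.zero (C := DCat A)
    have h (i : ℤ) : IsZero (cohomology i Z) :=
      (DerivedCategory.homologyFunctor (ModuleCat.{u} A) i).map_isZero hZ
    refine ⟨Z, hZ, ⟨0, 0, fun i _ ↦ h i⟩, fun i ↦ ?_⟩
    have := ModuleCat.subsingleton_of_isZero (h i)
    infer_instance

instance : (Dbf A).IsStableUnderShift ℤ where
  isStableUnderShiftBy n :=
    { le_shift := fun M ⟨⟨a, b, h₁⟩, h₂⟩ ↦ by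
        have e (i : ℤ) : cohomology i (M⟦n⟧) ≅ cohomology (n + i) M :=
          ((DerivedCategory.homologyFunctor (ModuleCat.{u} A) 0).shiftIso n i (n + i) rfl).app M
        exact ⟨⟨a - n, b - n, fun i hi ↦ (h₁ (n + i) (by lia)).of_iso (e i)⟩, fun i ↦
          have := h₂ (n + i)
          Module.Finite.equiv (e i).symm.toLinearEquiv⟩ }

instance [IsNoetherianRing A] : (Dbf A).IsTriangulatedClosed₂ :=
  .mk' fun T hT ⟨⟨a, b, h₁⟩, h₂⟩ ⟨⟨a', b', h₁'⟩, h₂'⟩ ↦ by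
    have ex (i : ℤ) := DerivedCategory.HomologySequence.exact₂ T hT i
    refine ⟨⟨min a a', max b b', fun i hi ↦ ?_⟩, fun i ↦ ?_⟩
    · exact (ex i).isZero_of_both_zeros ((h₁ i (by lia)).eq_of_src _ _)
        ((h₁' i (by lia)).eq_of_tgt _ _)
    · have := h₂ i
      have := h₂' i
      have := isNoetherian_of_range_eq_ker _ _ (ex i).moduleCat_range_eq_ker
      change Module.Finite A (cohomology i T.obj₂)
      infer_instance

instance [IsNoetherianRing A] : (Dbf A).IsTriangulated where

/-- A K-injective resolution of an object `R` of the derived category. -/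
structure KInjectiveResolution (R : DCat A) where
  /-- The K-injective complex. -/
  I : Cplx A
  isKInjective : I.IsKInjective
  /-- The isomorphism in the derived category. -/
  iso : R ≅ DerivedCategory.Q.obj I

attribute [instance] KInjectiveResolution.isKInjective

lemma nonempty_kInjectiveResolution (R : DCat A) (hR : Db A R) :
    Nonempty (KInjectiveResolution R) := by
  obtain ⟨a, b, h⟩ := hR
  have : R.IsGE a := (DerivedCategory.isGE_iff _ _).2 fun i hi ↦ h i (Or.inl hi)
  obtain ⟨K, _, ⟨e⟩⟩ := R.exists_iso_Q_obj_of_isGE a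
  obtain ⟨I, f, _, _, _⟩ := CochainComplex.Plus.modelCategoryQuillen.exists_quasiIso_injective K a
  exact ⟨⟨I, CochainComplex.isKInjective_of_injective I a,
    e ≪≫ asIso (DerivedCategory.Q.map f)⟩⟩

/-- A chosen K-injective resolution of an object with bounded cohomology. -/
def kInjectiveResolution (R : DCat A) (hR : Db A R) : KInjectiveResolution R :=
  (nonempty_kInjectiveResolution R hR).some

/-- The contravariant functor `RHom_A(-, R)` on the derived category, for `R` with bounded
cohomology. -/
def RHom (R : DCat A) (hR : Db A R) : (DCat A)ᵒᵖ ⥤ DCat A :=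
  derivedHom (kInjectiveResolution R hR).I

instance rHomCommShift (R : DCat A) (hR : Db A R) : (RHom R hR).CommShift ℤ :=
  derivedHomCommShift _

/-- The canonical morphism of functors `M ⟶ RHom_A(RHom_A(M, R), R)`. -/
def biduality (R : DCat A) (hR : Db A R) : 𝟭 (DCat A) ⟶ (RHom R hR).rightOp ⋙ RHom R hR :=
  derivedHomBiduality (kInjectiveResolution R hR).I

/-- The morphism `A ⟶ Hom_A(I, I)`, `a ↦ a • id`, with `A` placed in degree `0`. -/
def homothety (I : Cplx A) : (CochainComplex.singleFunctor (ModuleCat.{u} A) 0).obj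
    (ModuleCat.of A A) ⟶ homComplex I I :=
  HomologicalComplex.mkHomFromSingle
    (ModuleCat.ofHom (LinearMap.toSpanSingleton A (Cochain I I 0) (Cochain.ofHom (𝟙 I)))) (by
      intro k _
      ext
      have key : δ 0 k ((1 : A) • Cochain.ofHom (𝟙 I)) = 0 := by simp
      exact key)

/-- The canonical morphism `A ⟶ RHom_A(R, R)`: for the K-injective resolution `R ≅ I`, it is
induced by `A ⟶ Hom_A(I, I)`, `a ↦ a • id`. -/
def homothetyRHom (R : DCat A) (hR : Db A R) :
    (DerivedCategory.singleFunctor (ModuleCat.{u} A) 0).obj (ModuleCat.of A A) ⟶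
      (RHom R hR).obj (op R) :=
  let ρ := kInjectiveResolution R hR
  (DerivedCategory.singleFunctorIsoCompQ (ModuleCat.{u} A) 0).hom.app (ModuleCat.of A A) ≫
    DerivedCategory.Q.map (homothety ρ.I) ≫ (derivedHomIso ρ.I).inv.app (op ρ.I) ≫
      (derivedHom ρ.I).map ρ.iso.hom.op

/-- There is an integer `i₀` such that `Ext^i_A(M, R) = H^i(RHom_A(M, R))` vanishes for all
`A`-modules `M` and all `i > i₀`. -/
def HasFiniteInjectiveDimension (R : DCat A) (hR : Db A R) : Prop :=
  ∃ i₀ : ℤ, ∀ (M : ModuleCat.{u} A) (i : ℤ), i₀ < i →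
    IsZero (cohomology i ((RHom R hR).obj
      (op ((DerivedCategory.singleFunctor (ModuleCat.{u} A) 0).obj M))))

/-- `R` is a dualizing complex: it has bounded finitely generated cohomology and finite injective
dimension, and the canonical morphism `A ⟶ RHom_A(R, R)` is an isomorphism. -/
structure IsDualizing (R : DCat A) : Prop where
  mem_Dbf : Dbf A R
  hasFiniteInjectiveDimension : HasFiniteInjectiveDimension R mem_Dbf.1
  isIso_homothetyRHom : IsIso (homothetyRHom R mem_Dbf.1)

/-- The functor from the opposite of `D^b_f` to `D^b_f` induced by `RHom_A(-, R)`. -/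
def dualityFunctor (R : DCat A) (hR : Db A R)
    (h : ∀ M : DCat A, Dbf A M → Dbf A ((RHom R hR).obj (op M))) :
    (Dbf A).FullSubcategoryᵒᵖ ⥤ (Dbf A).FullSubcategory :=
  (Dbf A).lift ((Dbf A).ι.op ⋙ RHom R hR) fun M ↦ h M.unop.obj M.unop.property

instance (R : DCat A) (hR : Db A R)
    (h : ∀ M : DCat A, Dbf A M → Dbf A ((RHom R hR).obj (op M))) :
    (dualityFunctor R hR h).CommShift ℤ :=
  inferInstanceAs (((Dbf A).lift ((Dbf A).ι.op ⋙ RHom R hR) _).CommShift ℤ)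

end

end DualizingComplex

open DualizingComplex

open CategoryTheory Limits Opposite CochainComplex.HomComplex
open scoped Pretriangulated.Opposite

namespace DualizingComplex

noncomputable section

/-! Two dévissages reduce the theorem to the module `A`. Truncation triangles build every object of
`Dbf A` from finitely generated modules placed in single degrees (`Dbf_devissage`), and since `A` is
noetherian each of these is a quotient of some `A^(m+1)` with finitely generated kernel
(`exists_presentation`). For `A` itself, `RHom(A, R) ≅ R`, and under this identification the
biduality morphism becomes the homothety `A ⟶ RHom(R, R)`, an isomorphism by hypothesis
(`homothety_comp_homComplexMap`).

Free resolutions need not terminate, so the second dévissage has to start from degree estimates.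
Write `D = RHom(-, R)`, let `R` live in degrees `≥ r₀`, and let `i₀` bound the injective dimension.
If `M` lives in degrees `≤ b`, then `D M` lives in degrees `≥ r₀ - b` (`isGE_rHom_obj`); if `M` in
`Dbf A` lives in degrees `≥ a`, then `D M` lives in degrees `≤ i₀ - a` (`isLE_rHom_obj`). Hence for
`X` concentrated in degree `n`, `D D X` lives in degrees `≤ n + i₀ - r₀`. For a fixed cohomological
degree, both finiteness of `D X` and bijectivity of biduality are therefore trivial when `n` is very
negative. A presentation gives a triangle `F ⟶ X ⟶ X₁⟦1⟧ ⟶ F⟦1⟧` with `F` free and `X₁⟦1⟧` one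
degree lower, which carries the claim from `n` to `n + 1` (`finite_cohomology_rHom_obj`,
`isIso_cohomologyBiduality_of_fgHeart`).

This requires `D` to be triangulated, which is checked on complexes: `Hom(cone f, I)` is the cocone
of `Hom(f, I)`, connecting morphisms included. For biduality, naturality, the four lemma in
cohomology and stability of reflexive objects under shifts suffice. -/

open CochainComplex

/-! ### Hom out of a mapping cone is a mapping cocone -/

section

variable {A : Type u} [CommRing A]

/-- For `f : K ⟶ L`, the cochain of degree `-1` which sends `ψ` of degree `n` in
`Hom_A(mappingCone f, I)` to `(-1)^{n - 1} inl ≫ ψ`. -/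
def homComplexConeCochain {K L : Cplx A} (f : K ⟶ L) (I : Cplx A) :
    Cochain (homComplex (mappingCone f) I) (homComplex K I) (-1) :=
  Cochain.mk fun p q hpq ↦ ModuleCat.ofHom (Y := Cochain K I q)
    { toFun := fun (ψ : Cochain (mappingCone f) I p) ↦
        q.negOnePow • (mappingCone.inl f).comp ψ (by lia)
      map_add' := fun φ ψ ↦ by simp
      map_smul' := fun a φ ↦ by
        rw [Cochain.comp_smul]; exact smul_comm _ _ _ }

/-- The composite `f ≫ inr` is null-homotopic through `inl`, and precomposing with this homotopy
gives the relation demanded by `mappingCocone.lift`. The sign in `homComplexConeCochain` absorbs the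
one produced by the Leibniz rule. -/
lemma δ_homComplexConeCochain {K L : Cplx A} (f : K ⟶ L) (I : Cplx A) :
    δ (-1) 0 (homComplexConeCochain f I) +
      Cochain.ofHom (homComplexMap (mappingCone.inr f) I ≫ homComplexMap f I) = 0 := by
  ext p : 1
  rw [Cochain.add_v, δ_v (-1) 0 (by lia) _ p p (add_zero p) (p - 1) (p + 1) (by lia) (by lia), Int.negOnePow_zero,
    one_smul]
  ext ψ
  have key (ψ : Cochain (mappingCone f) I p) :
      δ (p - 1) p ((p - 1).negOnePow • (mappingCone.inl f).comp ψ (show -1 + p = p - 1 by lia)) +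
      (p.negOnePow • (mappingCone.inl f).comp (δ p (p + 1) ψ) (show -1 + (p + 1) = p by lia)) +
      (Cochain.ofHom f).comp ((Cochain.ofHom (mappingCone.inr f)).comp ψ (zero_add p))
        (zero_add p) = 0 := by
    rw [δ_units_smul, δ_comp (mappingCone.inl f) ψ _ 0 (p + 1) p (by lia) (by lia) (by lia)]
    simp [smul_smul, Int.negOnePow_sub]
  exact key ψ

/-- The comparison between `Hom_A(mappingCone f, I)` and the mapping cocone of
`Hom_A(L, I) ⟶ Hom_A(K, I)`. -/
def homComplexConeComparison {K L : Cplx A} (f : K ⟶ L) (I : Cplx A) :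
    homComplex (mappingCone f) I ⟶ mappingCocone (homComplexMap f I) :=
  mappingCocone.lift _ (homComplexMap (mappingCone.inr f) I) (homComplexConeCochain f I)
    (δ_homComplexConeCochain f I)

/-- Precomposition with `snd`, as a map `Hom_A(L, I)^n ⟶ Hom_A(mappingCone f, I)^n`. -/
def homComplexConeSnd {K L : Cplx A} (f : K ⟶ L) (I : Cplx A) (n : ℤ) :
    (homComplex L I).X n ⟶ (homComplex (mappingCone f) I).X n :=
  ModuleCat.ofHom (X := Cochain L I n) (Y := Cochain (mappingCone f) I n)
    { toFun := fun φ ↦ (mappingCone.snd f).comp φ (zero_add n)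
      map_add' := fun φ ψ ↦ by simp
      map_smul' := fun a φ ↦ by simp }

/-- Precomposition with `fst` up to sign, as a map
`Hom_A(K, I)^n ⟶ Hom_A(mappingCone f, I)^{n + 1}`. -/
def homComplexConeFst {K L : Cplx A} (f : K ⟶ L) (I : Cplx A) (n m : ℤ) (h : n + 1 = m) :
    (homComplex K I).X n ⟶ (homComplex (mappingCone f) I).X m :=
  ModuleCat.ofHom (X := Cochain K I n) (Y := Cochain (mappingCone f) I m)
    { toFun := fun φ ↦ n.negOnePow • (mappingCone.fst f).1.comp φ (by lia)
      map_add' := fun φ ψ ↦ by simp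
      map_smul' := fun a φ ↦ by
        rw [Cochain.comp_smul]; exact smul_comm _ _ _ }

section

variable {K L : Cplx A} (f : K ⟶ L) (I : Cplx A) (n m : ℤ) (h : n + 1 = m)

lemma homComplexMap_inr_comp_homComplexConeSnd_add :
    (homComplexMap (mappingCone.inr f) I).f m ≫ homComplexConeSnd f I m +
      (homComplexConeCochain f I).v m n (by lia) ≫ homComplexConeFst f I n m h = 𝟙 _ := by
  ext ψ
  have key (ψ : Cochain (mappingCone f) I m) :
      (mappingCone.snd f).comp ((Cochain.ofHom (mappingCone.inr f)).comp ψ (zero_add m))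
        (zero_add m) + n.negOnePow • (mappingCone.fst f).1.comp
          (n.negOnePow • (mappingCone.inl f).comp ψ (show -1 + m = n by lia)) (by lia) = ψ := by
    rw [mappingCone.ext_cochain_from_iff f n m h]
    simp [smul_smul]
  exact key ψ

lemma homComplexConeSnd_comp_homComplexMap_inr :
    homComplexConeSnd f I n ≫ (homComplexMap (mappingCone.inr f) I).f n = 𝟙 _ := by
  ext φ
  have key (φ : Cochain L I n) : (Cochain.ofHom (mappingCone.inr f)).comp
      ((mappingCone.snd f).comp φ (zero_add n)) (zero_add n) = φ := by
    simp
  exact key φ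

lemma homComplexConeSnd_comp_homComplexConeCochain :
    homComplexConeSnd f I m ≫ (homComplexConeCochain f I).v m n (by lia) = 0 := by
  ext φ
  have key (φ : Cochain L I m) : n.negOnePow • (mappingCone.inl f).comp
      ((mappingCone.snd f).comp φ (zero_add m)) (show -1 + m = n by lia) = 0 := by
    simp
  exact key φ

lemma homComplexConeFst_comp_homComplexMap_inr :
    homComplexConeFst f I n m h ≫ (homComplexMap (mappingCone.inr f) I).f m = 0 := by
  ext φ
  have key (φ : Cochain K I n) : (Cochain.ofHom (mappingCone.inr f)).comp
      (n.negOnePow • (mappingCone.fst f).1.comp φ (show 1 + n = m by lia)) (zero_add m) = 0 := by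
    simp
  exact key φ

lemma homComplexConeFst_comp_homComplexConeCochain :
    homComplexConeFst f I n m h ≫ (homComplexConeCochain f I).v m n (by lia) = 𝟙 _ := by
  ext φ
  have key (φ : Cochain K I n) : n.negOnePow • (mappingCone.inl f).comp
      (n.negOnePow • (mappingCone.fst f).1.comp φ (show 1 + n = m by lia))
        (show -1 + m = n by lia) = φ := by
    simp [smul_smul]
  exact key φ

@[simp]
lemma homComplexConeComparison_f_fst_f :
    (homComplexConeComparison f I).f n ≫ (mappingCocone.fst (homComplexMap f I)).f n =
      (homComplexMap (mappingCone.inr f) I).f n :=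
  mappingCocone.lift_f_fst_f _ _ _ (δ_homComplexConeCochain f I) n

@[simp]
lemma homComplexConeComparison_f_snd_v (hnm : m + -1 = n) :
    (homComplexConeComparison f I).f m ≫ (mappingCocone.snd (homComplexMap f I)).v m n hnm =
      (homComplexConeCochain f I).v m n hnm :=
  mappingCocone.lift_f_snd_v _ _ _ (δ_homComplexConeCochain f I) m n hnm

lemma mappingCocone_hom_ext {C : Type*} [Category* C] [Preadditive C] {K L : CochainComplex C ℤ}
    (φ : K ⟶ L) [HomologicalComplex.HasHomotopyCofiber φ] (p q : ℤ) (hpq : p + -1 = q) {M : C}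
    {a b : M ⟶ (mappingCocone φ).X p}
    (h₁ : a ≫ (mappingCocone.fst φ).f p = b ≫ (mappingCocone.fst φ).f p)
    (h₂ : a ≫ (mappingCocone.snd φ).v p q hpq = b ≫ (mappingCocone.snd φ).v p q hpq) : a = b := by
  rw [← Category.comp_id a, ← Category.comp_id b, ← mappingCocone.id_X φ p q hpq]
  simp [reassoc_of% h₁, reassoc_of% h₂]

end

/-- In each degree the cone is the sum of its two pieces, so a cochain out of it is a pair of
cochains. The inverse reassembles the pair by precomposing with `snd` and, up to sign, with `fst`.
-/
instance isIso_homComplexConeComparison {K L : Cplx A} (f : K ⟶ L) (I : Cplx A) :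
    IsIso (homComplexConeComparison f I) := by
  have (n : ℤ) : IsIso ((homComplexConeComparison f I).f n) := by
    refine ⟨(mappingCocone.fst (homComplexMap f I)).f n ≫ homComplexConeSnd f I n +
      (mappingCocone.snd (homComplexMap f I)).v n (n - 1) (by lia) ≫
        homComplexConeFst f I (n - 1) n (by lia), ?_, ?_⟩
    · have h₁ := homComplexConeComparison_f_fst_f f I n
      have h₂ := homComplexConeComparison_f_snd_v f I (n - 1) n (by lia)
      simp [reassoc_of% h₁, reassoc_of% h₂, homComplexMap_inr_comp_homComplexConeSnd_add]
    · refine mappingCocone_hom_ext _ n (n - 1) (by lia) ?_ ?_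
      · simp [homComplexConeSnd_comp_homComplexMap_inr, homComplexConeFst_comp_homComplexMap_inr]
      · simp [homComplexConeSnd_comp_homComplexConeCochain,
          homComplexConeFst_comp_homComplexConeCochain]
  exact HomologicalComplex.Hom.isIso_of_components _

end

/-! ### The derived contravariant Hom is triangulated -/

section

variable {A : Type u} [CommRing A]

/-- The triangle `Hom_A(mappingCone f, I) ⟶ Hom_A(L, I) ⟶ Hom_A(K, I) ⟶ ...` obtained by applying
`Hom_A(-, I)` to the triangle of the mapping cone of `f : K ⟶ L`. -/
abbrev homComplexConeTriangle {K L : Cplx A} (f : K ⟶ L) (I : Cplx A) :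
    Pretriangulated.Triangle (Cplx A) :=
  (homComplexFunctor I).mapTriangle.obj
    ((Pretriangulated.triangleOpEquivalence (Cplx A)).functor.obj (op (mappingCone.triangle f)))

/-- The connecting morphism `mappingCone f ⟶ K⟦1⟧`. -/
def coneConnecting {K L : Cplx A} (f : K ⟶ L) : mappingCone f ⟶ K⟦(1 : ℤ)⟧ :=
  (mappingCone.triangle f).mor₃

lemma coneConnecting_f {K L : Cplx A} (f : K ⟶ L) (n : ℤ) :
    (coneConnecting f).f n = - (mappingCone.fst f).1.v n (n + 1) rfl := by
  refine mappingCone.ext_from f (n + 1) n rfl ?_ ?_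
  · refine Eq.trans ?_ ((Preadditive.comp_neg _ _).trans
      (congrArg (- ·) (mappingCone.inl_v_fst_v f (n + 1) n rfl))).symm
    exact mappingCone.inl_v_triangle_mor₃_f f (n + 1) n (by lia)
  · refine Eq.trans ?_ ((Preadditive.comp_neg _ _).trans
      ((congrArg (- ·) (mappingCone.inr_f_fst_v f n (n + 1) rfl)).trans neg_zero)).symm
    exact mappingCone.inr_f_triangle_mor₃_f f n

/-- Unwinds the triangulated structure of the opposite category: the identification of the shift
there with the opposite of the shift by `-1` cancels against the same identification inside the
`CommShift` structure. -/
lemma homComplexConeTriangle_mor₃ {K L : Cplx A} (f : K ⟶ L) (I : Cplx A) :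
    (homComplexConeTriangle f I).mor₃ =
      homComplexMap ((shiftFunctorCompIsoId (Cplx A) (1 : ℤ) (-1) (by lia)).hom.app K) I ≫
        (homComplexShiftIso (K⟦(1 : ℤ)⟧) I 1 (-1) (by lia)).hom ≫
          (homComplexMap (coneConnecting f) I)⟦(1 : ℤ)⟧' := by
  have nat := ((homComplexFunctor I).commShiftIso (1 : ℤ)).hom.naturality
    (mappingCone.triangle f).mor₃.op
  have h₁ : (homComplexConeTriangle f I).mor₃ = (homComplexFunctor I).map
      ((Pretriangulated.opShiftFunctorEquivalence (Cplx A) 1).counitIso.inv.app (op K)) ≫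
      ((homComplexFunctor I).commShiftIso (1 : ℤ)).hom.app (op (K⟦(1 : ℤ)⟧)) ≫
        (homComplexMap (coneConnecting f) I)⟦(1 : ℤ)⟧' := by
    refine ((homComplexFunctor I).map_comp_assoc _ _ _).trans ?_
    exact congrArg (_ ≫ ·) nat
  have h₂ : (homComplexFunctor I).map
      ((Pretriangulated.opShiftFunctorEquivalence (Cplx A) 1).counitIso.inv.app (op K)) ≫
      ((homComplexFunctor I).commShiftIso (1 : ℤ)).hom.app (op (K⟦(1 : ℤ)⟧)) =
      homComplexMap ((shiftFunctorCompIsoId (Cplx A) (1 : ℤ) (-1) (by lia)).hom.app K) I ≫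
        (homComplexShiftIso (K⟦(1 : ℤ)⟧) I 1 (-1) (by lia)).hom := by
    have h₃ : ((homComplexFunctor I).commShiftIso (1 : ℤ)).hom.app (op (K⟦(1 : ℤ)⟧)) =
        (homComplexFunctorShiftIso I 1 (-1) (by lia)).hom.app (op (K⟦(1 : ℤ)⟧)) := rfl
    rw [Pretriangulated.opShiftFunctorEquivalence_counitIso_inv_app _ 1 (-1), h₃,
      homComplexFunctorShiftIso_hom_app, Functor.map_comp, Category.assoc]
    congr 1
    refine ((homComplexFunctor I).map_comp_assoc _ _ _).symm.trans ?_
    refine (congrArg (· ≫ _) ((homComplexFunctor I).congr_map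
      (Iso.inv_hom_id_app _ _))).trans ?_
    rw [CategoryTheory.Functor.map_id]
    exact Category.id_comp _
  refine h₁.trans ((Category.assoc _ _ _).symm.trans ?_)
  exact (congrArg (· ≫ _) h₂).trans (Category.assoc _ _ _)

lemma eqToIso_inv_comp_eqToHom_comp {C : Type*} [Category* C] {X Y Z : C} (h : Y = X) (h' : Y = X)
    (f : X ⟶ Z) : (eqToIso h).inv ≫ eqToHom h' ≫ f = f := by
  subst h
  simp

lemma mappingCocone_triangle_mor₃_f {C : Type*} [Category* C] [Preadditive C]
    [HasBinaryBiproducts C] {K L : CochainComplex C ℤ} (φ : K ⟶ L) (n : ℤ) :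
    (mappingCocone.triangle φ).mor₃.f n = (mappingCocone.inr φ).1.v n (n + 1) rfl := by
  have h₁ : (mappingCocone.triangle φ).mor₃ = mappingCone.inr φ ≫
      (shiftFunctorCompIsoId _ (-1 : ℤ) 1 (by lia)).inv.app (mappingCone φ) := rfl
  have h₂ : (mappingCocone.inr φ).1 =
      (Cochain.ofHom (mappingCone.inr φ)).rightShift (-1) 1 (by lia) := rfl
  have h₃ := Cochain.rightShift_v (Cochain.ofHom (mappingCone.inr φ)) (-1) 1 (by lia) n (n + 1) rfl
    n (add_zero n)
  rw [Cochain.ofHom_v] at h₃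
  have h₄ : ((shiftFunctorCompIsoId (CochainComplex C ℤ) (-1 : ℤ) 1 (by lia)).inv.app
      (mappingCone φ)).f n =
        ((mappingCone φ).shiftFunctorObjXIso (-1) (n + 1) n (by lia)).inv := by
    simp [shiftFunctorCompIsoId, shiftFunctorAdd'_hom_app_f', shiftFunctorZero_inv_app_f]
    rfl
  exact (HomologicalComplex.congr_hom h₁ n).trans ((congrArg ((mappingCone.inr φ).f n ≫ ·) h₄).trans
    h₃.symm)

lemma neg_comp_units_smul {C : Type*} [Category* C] [Preadditive C] {X Y Z : C} (f : X ⟶ Y)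
    (g : Y ⟶ Z) (a b : ℤˣ) (h : a = -b) : (-f) ≫ (a • g) = b • f ≫ g := by
  subst h
  simp

lemma leftUnshift_shiftFunctorCompIsoId_comp_v (K I : Cplx A) (n : ℤ) (φ : Cochain K I n)
    (p q : ℤ) (hpq : p + (n + 1) = q) :
    (Cochain.leftUnshift
      ((Cochain.ofHom ((shiftFunctorCompIsoId (Cplx A) (1 : ℤ) (-1) (by lia)).hom.app K)).comp φ
        (zero_add n)) (n + 1) (by lia)).v p q hpq =
      (n + 1).negOnePow • φ.v (p + 1) q (by lia) := by
  rw [Cochain.leftUnshift_v _ _ _ p q hpq (p + 1) (by lia)]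
  congr 1
  · simp [Int.negOnePow_add]
  · simp [HomologicalComplex.XIsoOfEq, shiftFunctorCompIsoId, shiftFunctorAdd'_inv_app_f',
      shiftFunctorZero_hom_app_f]
    apply eqToIso_inv_comp_eqToHom_comp

/-- Two signs meet: the cone's connecting morphism is `-fst`, and unshifting contributes
`(-1)^(n+1)`. Their product is the `(-1)^n` built into `homComplexConeFst`. -/
lemma homComplexConeTriangle_mor₃_f {K L : Cplx A} (f : K ⟶ L) (I : Cplx A) (n : ℤ) :
    (homComplexConeTriangle f I).mor₃.f n = homComplexConeFst f I n (n + 1) rfl := by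
  rw [homComplexConeTriangle_mor₃]
  ext φ
  have key (φ : Cochain K I n) :
      (Cochain.ofHom (coneConnecting f)).comp (Cochain.leftUnshift
        ((Cochain.ofHom ((shiftFunctorCompIsoId (Cplx A) (1 : ℤ) (-1) (by lia)).hom.app K)).comp φ
          (zero_add n)) (n + 1) (by lia)) (zero_add (n + 1)) =
      n.negOnePow • (mappingCone.fst f).1.comp φ (show 1 + n = n + 1 by lia) := by
    ext p q hpq : 1
    rw [Cochain.zero_cochain_comp_v, Cochain.ofHom_v,
      leftUnshift_shiftFunctorCompIsoId_comp_v K I n φ p q hpq]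
    rw [coneConnecting_f, Cochain.units_smul_v,
      Cochain.comp_v _ _ (show 1 + n = n + 1 by lia) p (p + 1) q rfl (by lia)]
    exact neg_comp_units_smul _ _ _ _ (by simp [Int.negOnePow_add])
  exact key φ

/-- Both sides have zero component along `fst` and identity component along `snd`. This makes the
comparison isomorphism a morphism of triangles with no sign correction. -/
lemma homComplexConeTriangle_mor₃_comp {K L : Cplx A} (f : K ⟶ L) (I : Cplx A) :
    (homComplexConeTriangle f I).mor₃ ≫ (homComplexConeComparison f I)⟦(1 : ℤ)⟧' =
      (mappingCocone.triangle (homComplexMap f I)).mor₃ := by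
  ext n : 1
  rw [HomologicalComplex.comp_f, homComplexConeTriangle_mor₃_f]
  refine mappingCocone_hom_ext (homComplexMap f I) (n + 1) n (by lia) ?_ ?_
  · have h₁ := congrArg (homComplexConeFst f I n (n + 1) rfl ≫ ·)
      (homComplexConeComparison_f_fst_f f I (n + 1))
    refine h₁.trans ?_
    rw [homComplexConeFst_comp_homComplexMap_inr, mappingCocone_triangle_mor₃_f]
    exact (mappingCocone.inr_v_fst_f _ n (n + 1) rfl).symm
  · have h₁ := congrArg (homComplexConeFst f I n (n + 1) rfl ≫ ·)
      (homComplexConeComparison_f_snd_v f I n (n + 1) (by lia))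
    refine h₁.trans ?_
    rw [homComplexConeFst_comp_homComplexConeCochain, mappingCocone_triangle_mor₃_f]
    exact (mappingCocone.inr_v_snd_v _ n (n + 1) rfl).symm

/-- The triangle `Hom_A(mappingCone f, I) ⟶ Hom_A(L, I) ⟶ Hom_A(K, I) ⟶ ...` identifies to
the triangle of a mapping cocone. -/
def homComplexConeTriangleIso {K L : Cplx A} (f : K ⟶ L) (I : Cplx A) :
    homComplexConeTriangle f I ≅ mappingCocone.triangle (homComplexMap f I) :=
  Pretriangulated.Triangle.isoMk _ _
    (@asIso _ _ _ _ (homComplexConeComparison f I) (isIso_homComplexConeComparison f I)) (Iso.refl _)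
    (Iso.refl _)
    ((Category.comp_id _).trans (mappingCocone.lift_fst _ _ _ (δ_homComplexConeCochain f I)).symm)
    ((Category.comp_id _).trans (Category.id_comp _).symm)
    ((homComplexConeTriangle_mor₃_comp f I).trans (Category.id_comp _).symm)

variable [HasDerivedCategory.{w} (ModuleCat.{u} A)]

instance (I : Cplx A) [I.IsKInjective] : NatTrans.CommShift (derivedHomIso I).hom ℤ :=
  NatTrans.commShift_iso_hom_of_localization _ _ _ _ _

instance derivedHom_isTriangulated (I : Cplx A) [I.IsKInjective] :
    (derivedHom I).IsTriangulated where
  map_distinguished T hT := by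
    rw [Pretriangulated.mem_distTriang_op_iff'] at hT
    obtain ⟨T', hT', ⟨e⟩⟩ := hT
    rw [DerivedCategory.mem_distTriang_iff] at hT'
    obtain ⟨K, L, f, ⟨e'⟩⟩ := hT'
    -- Up to isomorphism the given triangle is the opposite of a mapping cone triangle of complexes,
    -- so its image is the image under `Q` of a mapping cocone triangle.
    refine Pretriangulated.isomorphic_distinguished _
      (DerivedCategory.mappingCocone_triangle_distinguished (homComplexMap f I)) _ ?_
    exact (derivedHom I).mapTriangle.mapIso (e ≪≫
      (Pretriangulated.triangleOpEquivalence (DCat A)).functor.mapIso e'.symm.op ≪≫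
        Functor.mapTriangleOpCompTriangleOpEquivalenceFunctorApp _ _) ≪≫
      (Functor.mapTriangleCompIso DerivedCategory.Q.op (derivedHom I)).symm.app _ ≪≫
      (Functor.mapTriangleIso (derivedHomIso I)).app _ ≪≫
      (Functor.mapTriangleCompIso (homComplexFunctor I) DerivedCategory.Q).app _ ≪≫
      DerivedCategory.Q.mapTriangle.mapIso (homComplexConeTriangleIso f I)

end

/-! ### Evaluation morphisms: shifts, and the case of `A` -/

section

variable {A : Type u} [CommRing A]

lemma negOnePow_shift_aux (k n p : ℤ) :
    (-n * k + -n * (-n - 1) / 2).negOnePow * (((k + n) * (p + -n)).negOnePow *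
      (n * p + n * (n - 1) / 2).negOnePow) = (k * p).negOnePow := by
  obtain ⟨a, ha⟩ := Int.even_mul_pred_self n
  obtain ⟨b, hb⟩ := Int.even_mul_pred_self (-n)
  rw [ha, hb, ← two_mul, ← two_mul, Int.mul_ediv_cancel_left _ two_ne_zero,
    Int.mul_ediv_cancel_left _ two_ne_zero, ← Int.negOnePow_add, ← Int.negOnePow_add,
    Int.negOnePow_eq_iff]
  -- The triangular numbers `n(n+1)/2` and `n(n-1)/2` add up to `n²`, cancelling the `-n²` from `(k
  -- + n)(p - n)`; what remains besides `kp` is twice this witness.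
  refine ⟨n * p - n * k, ?_⟩
  have : b + a = n * n := by linarith
  linear_combination this

lemma evalCochain_shift_v (K I : Cplx A) (n k p q : ℤ) (m : K.X (k + n)) (hpq : p + k = q)
    (φ : Cochain (K⟦n⟧) I p) :
    ((evalCochain (K⟦n⟧) I k m).v p q hpq).hom φ =
      (((evalCochain K I (k + n) m).leftShift (-n) k (by lia)).v p q hpq).hom
        (Cochain.leftUnshift φ (p + -n) (by lia)) := by
  rw [Cochain.leftShift_v _ _ _ _ p q hpq (p + -n) (by lia)]
  have h₁ : ((Cochain.leftUnshift φ (p + -n) (by lia)).v (k + n) q (by lia)) =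
      (n * p + n * (n - 1) / 2).negOnePow • φ.v k q (by lia) := by
    rw [Cochain.leftUnshift_v _ _ _ (k + n) q (by lia) k (by lia)]
    simp
    rfl
  change (k * p).negOnePow • (φ.v k q (by lia)).hom m =
    (-n * k + -n * (-n - 1) / 2).negOnePow • (((k + n) * (p + -n)).negOnePow •
      ((Cochain.leftUnshift φ (p + -n) (by lia)).v (k + n) q (by lia)).hom m)
  rw [h₁]
  change _ = _ • _ • (n * p + n * (n - 1) / 2).negOnePow • (φ.v k q (by lia)).hom m
  rw [smul_smul, smul_smul, mul_assoc, negOnePow_shift_aux]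

/-- The Koszul sign of the evaluation exactly compensates the signs of the two shift isomorphisms.
Consequently, being a quasi-isomorphism for the evaluation is stable under shifting `K`. -/
lemma evalMap_shift (K I : Cplx A) (n : ℤ) :
    evalMap (K⟦n⟧) I = (evalMap K I)⟦n⟧' ≫
      (homComplexShiftIso (homComplex K I) I n (-n) (by lia)).inv ≫
        homComplexMap (homComplexShiftIso K I (-n) n (by lia)).hom I := by
  ext k m
  refine Cochain.ext _ _ fun p q hpq ↦ ?_
  ext φ
  refine (evalCochain_shift_v K I n k p q m hpq φ).trans ?_
  have key (z : Cochain ((homComplex K I)⟦-n⟧) I k) (φ : Cochain (K⟦n⟧) I p) :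
      (z.v p q hpq).hom (Cochain.leftUnshift φ (p + -n) (by lia)) =
        (((Cochain.ofHom (homComplexShiftIso K I (-n) n (by lia)).hom).comp z
          (zero_add k)).v p q hpq).hom φ := by
    rw [Cochain.zero_cochain_comp_v, Cochain.ofHom_v]
    rfl
  exact key _ φ

lemma quasiIso_evalMap_shift (K I : Cplx A) (n : ℤ) (h : QuasiIso (evalMap K I)) :
    QuasiIso (evalMap (K⟦n⟧) I) := by
  rw [evalMap_shift]
  have h₁ : QuasiIso ((evalMap K I)⟦n⟧') := by
    rwa [quasiIso_shift_iff]
  have h₂ : IsIso (homComplexMap (homComplexShiftIso K I (-n) n (by lia)).hom I) :=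
    inferInstanceAs (IsIso ((homComplexFunctor I).map (homComplexShiftIso K I (-n) n (by lia)).hom.op))
  infer_instance

/-- Evaluation at `1 ∈ A`, as a morphism `Hom_A(A, I) ⟶ I`. -/
def homComplexSingleEval (I : Cplx A) :
    homComplex ((singleFunctor (ModuleCat.{u} A) 0).obj (ModuleCat.of A A)) I ⟶ I where
  f n := ModuleCat.ofHom
    { toFun := fun (φ : Cochain ((singleFunctor (ModuleCat.{u} A) 0).obj (ModuleCat.of A A)) I n) ↦
        (φ.v 0 n (zero_add n)).hom (((HomologicalComplex.singleObjXSelf (.up ℤ) 0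
          (ModuleCat.of A A)).inv).hom (1 : A))
      map_add' := fun φ ψ ↦ by
        simp
        rfl
      map_smul' := fun a φ ↦ by
        simp
        rfl }
  comm' n m hnm := by
    ext φ
    have key (φ : Cochain ((singleFunctor (ModuleCat.{u} A) 0).obj (ModuleCat.of A A)) I n) :
      (I.d n m).hom ((φ.v 0 n (zero_add n)).hom (((HomologicalComplex.singleObjXSelf (.up ℤ) 0
          (ModuleCat.of A A)).inv).hom (1 : A))) =
        ((δ n m φ).v 0 m (zero_add m)).hom (((HomologicalComplex.singleObjXSelf (.up ℤ) 0
          (ModuleCat.of A A)).inv).hom (1 : A)) := by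
      rw [δ_v n m hnm φ 0 m (zero_add m) n 1 (by have : n + 1 = m := hnm; lia) (by lia)]
      have : ((singleFunctor (ModuleCat.{u} A) 0).obj (ModuleCat.of A A)).d 0 1 = 0 := rfl
      rw [this]
      simp
      rfl
    exact key φ

/-- A cochain out of a complex concentrated in degree `0` is a single linear map `A ⟶ I^n`,
determined by an arbitrary value at `1`. -/
lemma isIso_homComplexSingleEval (I : Cplx A) : IsIso (homComplexSingleEval I) := by
  have (n : ℤ) : IsIso ((homComplexSingleEval I).f n) := by
    rw [ConcreteCategory.isIso_iff_bijective]
    have key₁ (φ : Cochain ((singleFunctor (ModuleCat.{u} A) 0).obj (ModuleCat.of A A)) I n)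
        (hφ : (φ.v 0 n (zero_add n)).hom (((HomologicalComplex.singleObjXSelf (.up ℤ) 0
          (ModuleCat.of A A)).inv).hom (1 : A)) = 0) : φ = 0 := by
      obtain ⟨f, rfl⟩ := Cochain.fromSingleMk_surjective φ n (zero_add n)
      have h₁ : (Cochain.fromSingleMk f (zero_add n)).v 0 n (zero_add n) =
        (HomologicalComplex.singleObjXSelf (.up ℤ) 0 (ModuleCat.of A A)).hom ≫ f :=
          Cochain.fromSingleMk_v f (zero_add n)
      have h₂ : f.hom (1 : A) = 0 := by
        rw [h₁] at hφ
        exact hφ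
      have h₃ : f = 0 := by
        ext
        exact h₂
      rw [h₃, Cochain.fromSingleMk_zero]
    have key₂ (x : I.X n) : ∃ φ : Cochain ((singleFunctor (ModuleCat.{u} A) 0).obj
        (ModuleCat.of A A)) I n, (φ.v 0 n (zero_add n)).hom
          (((HomologicalComplex.singleObjXSelf (.up ℤ) 0 (ModuleCat.of A A)).inv).hom (1 : A)) =
            x := by
      refine ⟨Cochain.fromSingleMk (ModuleCat.ofHom (LinearMap.toSpanSingleton A _ x))
        (zero_add n), ?_⟩
      refine (LinearMap.congr_fun (congrArg ModuleCat.Hom.hom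
        (Cochain.fromSingleMk_v (ModuleCat.ofHom (LinearMap.toSpanSingleton A (I.X n) x))
          (zero_add n))) _).trans ?_
      exact one_smul A x
    exact ⟨(injective_iff_map_eq_zero (ModuleCat.Hom.hom ((homComplexSingleEval I).f n))).2 key₁,
      key₂⟩
  exact HomologicalComplex.Hom.isIso_of_components _

/-- Both send `1` to the cochain `φ ↦ φ(1)`; the sign is trivial because `1` has degree `0`. Since
`Hom(A, I) ⟶ I` is an isomorphism, condition (ii) thus amounts to reflexivity of `A`. -/
lemma homothety_comp_homComplexMap (I : Cplx A) :
    homothety I ≫ homComplexMap (homComplexSingleEval I) I =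
      evalMap ((singleFunctor (ModuleCat.{u} A) 0).obj (ModuleCat.of A A)) I := by
  refine HomologicalComplex.from_single_hom_ext ?_
  ext
  refine Cochain.ext _ _ fun p q hpq ↦ ?_
  ext φ
  obtain rfl : p = q := by lia
  have h₀ (φ : Cochain ((singleFunctor (ModuleCat.{u} A) 0).obj (ModuleCat.of A A)) I p) :
      (φ.v 0 p (zero_add p)).hom (1 : A) = (((evalCochain ((singleFunctor (ModuleCat.{u} A) 0).obj
        (ModuleCat.of A A)) I 0 (1 : A)).v p p hpq).hom φ) := by
    refine Eq.trans ?_ (evalCochain_v_apply ((singleFunctor (ModuleCat.{u} A) 0).obj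
        (ModuleCat.of A A)) I 0 (1 : A) p p hpq φ).symm
    rw [zero_mul, Int.negOnePow_zero, one_smul]
  have h₁ : ((homothety I).f 0).hom (1 : A) = (1 : A) • Cochain.ofHom (𝟙 I) := by
    have h : (homothety I).f 0 = (HomologicalComplex.singleObjXSelf (.up ℤ) 0
      (ModuleCat.of A A)).hom ≫ ModuleCat.ofHom (LinearMap.toSpanSingleton A (Cochain I I 0)
        (Cochain.ofHom (𝟙 I))) := HomologicalComplex.mkHomFromSingle_f _ _
    exact LinearMap.congr_fun (congrArg ModuleCat.Hom.hom h) _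
  have h₂ : ((Cochain.ofHom (homComplexSingleEval I)).comp ((1 : A) • Cochain.ofHom (𝟙 I))
      (zero_add 0)).v p p hpq = (homComplexSingleEval I).f p := by
    rw [one_smul, Cochain.zero_cochain_comp_v, Cochain.ofHom_v, Cochain.ofHom_v,
      HomologicalComplex.id_f, Category.comp_id]
  have h₃ (z : Cochain I I 0) (h : z = (1 : A) • Cochain.ofHom (𝟙 I)) :
      (((Cochain.ofHom (homComplexSingleEval I)).comp z (zero_add 0)).v p p hpq).hom φ =
      ((homComplexSingleEval I).f p).hom φ := by
    rw [h, h₂]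
  exact (h₃ _ h₁).trans (h₀ φ)

end

/-! ### Biduality on the derived category, computed on complexes -/

section

variable {A : Type u} [CommRing A]

variable [HasDerivedCategory.{w} (ModuleCat.{u} A)]

lemma isIso_conj_iff {C : Type*} [Category* C] {X Y Z W : C} (e : X ≅ Y) (f : Y ⟶ Z) (e' : Z ≅ W) :
    IsIso (e.hom ≫ f ≫ e'.hom) ↔ IsIso f :=
  ⟨fun _ ↦ have := IsIso.of_isIso_comp_left e.hom (f ≫ e'.hom)
    IsIso.of_isIso_comp_right f e'.hom, fun _ ↦ inferInstance⟩

lemma isIso_derivedHomBiduality_app_Q_iff (I : Cplx A) [I.IsKInjective] (K : Cplx A) :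
    IsIso ((derivedHomBiduality I).app (DerivedCategory.Q.obj K)) ↔ QuasiIso (evalMap K I) := by
  have h : (derivedHomBiduality I).app (DerivedCategory.Q.obj K) =
      (Localization.Lifting.iso DerivedCategory.Q (qis A) DerivedCategory.Q (𝟭 _)).hom.app K ≫
        DerivedCategory.Q.map (evalMap K I) ≫
          (derivedHomBidualIso I).inv.app K :=
    Localization.liftNatTrans_app _ _ _ _ _ _ _ _
  rw [← DerivedCategory.isIso_Q_map_iff_quasiIso, h]
  exact isIso_conj_iff ((Localization.Lifting.iso DerivedCategory.Q (qis A) DerivedCategory.Q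
    (𝟭 _)).app K) _ ((derivedHomBidualIso I).symm.app K)

lemma isIso_derivedHomBiduality_app_shift (I : Cplx A) [I.IsKInjective] (M : DCat A) (n : ℤ)
    (h : IsIso ((derivedHomBiduality I).app M)) :
    IsIso ((derivedHomBiduality I).app (M⟦n⟧)) := by
  let e := DerivedCategory.Q.objObjPreimageIso M
  rw [← NatTrans.isIso_app_iff_of_iso _ e, isIso_derivedHomBiduality_app_Q_iff] at h
  rw [← NatTrans.isIso_app_iff_of_iso _ ((DerivedCategory.Q.commShiftIso n).app _ ≪≫
    (CategoryTheory.shiftFunctor (DCat A) n).mapIso e)]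
  exact (isIso_derivedHomBiduality_app_Q_iff I _).2 (quasiIso_evalMap_shift _ I n h)

lemma isIso_biduality_app_single (R : DCat A) (hR : Db A R) (h : IsIso (homothetyRHom R hR)) :
    IsIso ((biduality R hR).app
      ((DerivedCategory.singleFunctor (ModuleCat.{u} A) 0).obj (ModuleCat.of A A))) := by
  let ρ := kInjectiveResolution R hR
  have h₁ : IsIso (DerivedCategory.Q.map (homothety ρ.I)) :=
    (isIso_conj_iff ((DerivedCategory.singleFunctorIsoCompQ (ModuleCat.{u} A) 0).app
      (ModuleCat.of A A)) _ ((derivedHomIso ρ.I).symm.app (op ρ.I) ≪≫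
        (derivedHom ρ.I).mapIso ρ.iso.op)).1 h
  rw [DerivedCategory.isIso_Q_map_iff_quasiIso] at h₁
  have h₂ : IsIso (homComplexMap (homComplexSingleEval ρ.I) ρ.I) :=
    have := isIso_homComplexSingleEval ρ.I
    inferInstanceAs (IsIso ((homComplexFunctor ρ.I).map (homComplexSingleEval ρ.I).op))
  have h₃ : QuasiIso (evalMap ((singleFunctor (ModuleCat.{u} A) 0).obj (ModuleCat.of A A)) ρ.I) := by
    rw [← homothety_comp_homComplexMap]
    infer_instance
  rw [← isIso_derivedHomBiduality_app_Q_iff] at h₃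
  exact (NatTrans.isIso_app_iff_of_iso (derivedHomBiduality ρ.I)
    ((DerivedCategory.singleFunctorIsoCompQ (ModuleCat.{u} A) 0).app (ModuleCat.of A A))).2 h₃

/-- `RHom_A(A, R) ≅ R`. -/
lemma nonempty_rHom_single_iso (R : DCat A) (hR : Db A R) :
    Nonempty ((RHom R hR).obj (op ((DerivedCategory.singleFunctor (ModuleCat.{u} A) 0).obj
      (ModuleCat.of A A))) ≅ R) :=
  let ρ := kInjectiveResolution R hR
  ⟨(derivedHom ρ.I).mapIso ((DerivedCategory.singleFunctorIsoCompQ (ModuleCat.{u} A) 0).app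
      (ModuleCat.of A A)).symm.op ≪≫ (derivedHomIso ρ.I).app (op _) ≪≫
      DerivedCategory.Q.mapIso (@asIso _ _ _ _ (homComplexSingleEval ρ.I)
        (isIso_homComplexSingleEval ρ.I)) ≪≫ ρ.iso.symm⟩

end

/-! ### Lower degree bound and images of triangles -/

section

variable {A : Type u} [CommRing A]

lemma exactAt_homComplex (K I : Cplx A) (n : ℤ) (h : ∀ z : Cocycle K I n, z ∈ coboundaries K I n) :
    (homComplex K I).ExactAt n := by
  rw [HomologicalComplex.exactAt_iff' _ (n - 1) n (n + 1) (by simp) (by simp),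
    ShortComplex.moduleCat_exact_iff]
  intro z hz
  obtain ⟨m, hm, y, hy⟩ := h (Cocycle.mk z (n + 1) rfl hz)
  obtain rfl : m = n - 1 := by lia
  exact ⟨y, hy⟩

variable [HasDerivedCategory.{w} (ModuleCat.{u} A)]

/-- The cohomology `H^i Hom(K, I)` is `Hom(K, I⟦i⟧)` in the derived category. For `i < a - b` the
source lives in degrees `≤ b` and the target in degrees `≥ a - i > b`, so it vanishes. -/
lemma isGE_derivedHom_obj (I : Cplx A) [I.IsKInjective] (M : DCat A) (a b : ℤ)
    [(DerivedCategory.Q.obj I).IsGE a] [M.IsLE b] :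
    ((derivedHom I).obj (op M)).IsGE (a - b) := by
  let K := DerivedCategory.Q.objPreimage M
  let e : DerivedCategory.Q.obj K ≅ M := DerivedCategory.Q.objObjPreimageIso M
  have hK : (DerivedCategory.Q.obj K).IsLE b :=
    DerivedCategory.TStructure.t.isLE_of_iso e.symm b
  rw [DerivedCategory.isGE_iff]
  intro i hi
  refine IsZero.of_iso ?_ ((DerivedCategory.homologyFunctor (ModuleCat.{u} A) i).mapIso
    ((derivedHom I).mapIso e.op ≪≫ (derivedHomIso I).app (op K)) ≪≫
      (DerivedCategory.homologyFunctorFactors (ModuleCat.{u} A) i).app (homComplex K I))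
  refine HomologicalComplex.ExactAt.isZero_homology (exactAt_homComplex K I i fun z ↦ ?_)
  rw [← CohomologyClass.toHom_mk_eq_zero_iff]
  -- K-injectivity allows vanishing of the homotopy class to be tested in the derived category.
  refine (IsKInjective.Qh_map_bijective _ (I⟦i⟧)).injective ?_
  have h₁ : DerivedCategory.TStructure.t.IsGE
      ((DerivedCategory.Q ⋙ CategoryTheory.shiftFunctor (DCat A) i).obj I) (a - i) :=
    DerivedCategory.TStructure.t.isGE_shift _ a i (a - i) (by lia)
  have h₂ := DerivedCategory.TStructure.t.isGE_of_iso ((DerivedCategory.Q.commShiftIso i).symm.app I ≪≫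
    (DerivedCategory.quotientCompQhIso (ModuleCat.{u} A)).symm.app (I⟦i⟧)) (a - i)
  have h₃ := DerivedCategory.TStructure.t.isLE_of_iso
    ((DerivedCategory.quotientCompQhIso (ModuleCat.{u} A)).symm.app K) b
  rw [Functor.map_zero]
  exact DerivedCategory.TStructure.t.zero_of_isLE_of_isGE _ b (a - i) (by lia) h₃ h₂

lemma exists_distinguished_of_contravariant (D : (DCat A)ᵒᵖ ⥤ DCat A) [D.CommShift ℤ]
    [D.IsTriangulated] {T : Pretriangulated.Triangle (DCat A)} (hT : T ∈ distTriang (DCat A)) :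
    ∃ δ, Pretriangulated.Triangle.mk (D.map T.mor₂.op) (D.map T.mor₁.op) δ ∈
      distTriang (DCat A) :=
  ⟨_, D.map_distinguished _ (Pretriangulated.op_distinguished T hT)⟩

lemma exists_distinguished_bidual (D : (DCat A)ᵒᵖ ⥤ DCat A) [D.CommShift ℤ]
    [D.IsTriangulated] {T : Pretriangulated.Triangle (DCat A)} (hT : T ∈ distTriang (DCat A)) :
    ∃ δ, Pretriangulated.Triangle.mk ((D.rightOp ⋙ D).map T.mor₁)
      ((D.rightOp ⋙ D).map T.mor₂) δ ∈ distTriang (DCat A) := by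
  obtain ⟨δ, h⟩ := exists_distinguished_of_contravariant D hT
  exact exists_distinguished_of_contravariant D h

end

/-! ### Four lemmas and dévissage along truncations -/

section

variable {A : Type u} [CommRing A]

variable [HasDerivedCategory.{w} (ModuleCat.{u} A)]

lemma map_mor₂_mor₁_apply (F : DCat A ⥤ ModuleCat.{u} A) [F.IsHomological]
    {T : Pretriangulated.Triangle (DCat A)} (hT : T ∈ distTriang (DCat A)) (x : F.obj T.obj₁) :
    (F.map T.mor₂).hom ((F.map T.mor₁).hom x) = 0 := by
  have h : F.map T.mor₁ ≫ F.map T.mor₂ = 0 := by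
    rw [← F.map_comp, Pretriangulated.comp_distTriang_mor_zero₁₂ _ hT, F.map_zero]
  exact LinearMap.congr_fun (congrArg ModuleCat.Hom.hom h) x

lemma exists_map_mor₁_apply_eq (F : DCat A ⥤ ModuleCat.{u} A) [F.IsHomological]
    {T : Pretriangulated.Triangle (DCat A)} (hT : T ∈ distTriang (DCat A)) (x : F.obj T.obj₂)
    (hx : (F.map T.mor₂).hom x = 0) : ∃ y : F.obj T.obj₁, (F.map T.mor₁).hom y = x :=
  (ShortComplex.moduleCat_exact_iff _).1 (F.map_distinguished_exact T hT) x hx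

lemma naturality_apply {F G : DCat A ⥤ ModuleCat.{u} A} (τ : F ⟶ G) {X Y : DCat A} (f : X ⟶ Y) (x : F.obj X) :
    (τ.app Y).hom ((F.map f).hom x) = (G.map f).hom ((τ.app X).hom x) :=
  LinearMap.congr_fun (congrArg ModuleCat.Hom.hom (τ.naturality f)) x

/-- The four lemma for a natural transformation of homological functors. -/
lemma epi_app_obj₂ {F G : DCat A ⥤ ModuleCat.{u} A} [F.IsHomological] [G.IsHomological]
    (τ : F ⟶ G) {T : Pretriangulated.Triangle (DCat A)} (hT : T ∈ distTriang (DCat A))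
    (h₁ : Epi (τ.app T.obj₁)) (h₃ : Epi (τ.app T.obj₃))
    (h₄ : Mono (τ.app (T.obj₁⟦(1 : ℤ)⟧))) : Epi (τ.app T.obj₂) := by
  rw [ModuleCat.epi_iff_surjective] at h₁ h₃ ⊢
  rw [ModuleCat.mono_iff_injective] at h₄
  intro y
  -- Naturality along `T.mor₃` involves the component of `τ` at the shifted object itself, so no
  -- compatibility of `τ` with shifts is needed.
  have hT' := Pretriangulated.rot_of_distTriang _ hT
  obtain ⟨z, hz⟩ := h₃ ((G.map T.mor₂).hom y)
  obtain ⟨x, hx⟩ : ∃ x, (F.map T.mor₂).hom x = z := exists_map_mor₁_apply_eq F hT' z (h₄ (by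
    refine (naturality_apply τ _ _).trans (Eq.trans ?_ (map_zero _).symm)
    refine (congrArg (G.map T.mor₃).hom hz).trans ?_
    exact map_mor₂_mor₁_apply G hT' y))
  obtain ⟨w, hw⟩ := exists_map_mor₁_apply_eq G hT (y - (τ.app T.obj₂).hom x) (by
    rw [map_sub, ← naturality_apply, sub_eq_zero]
    exact hz.symm.trans (congrArg (τ.app T.obj₃).hom hx.symm))
  obtain ⟨v, hv⟩ := h₁ w
  refine ⟨x + (F.map T.mor₁).hom v, ?_⟩
  refine (map_add _ _ _).trans ?_
  rw [add_comm, ← eq_sub_iff_add_eq, ← hw]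
  exact (naturality_apply τ _ _).trans (congrArg (G.map T.mor₁).hom hv)

/-- The four lemma for a natural transformation of homological functors. -/
lemma mono_app_obj₂ {F G : DCat A ⥤ ModuleCat.{u} A} [F.IsHomological] [G.IsHomological]
    (τ : F ⟶ G) {T : Pretriangulated.Triangle (DCat A)} (hT : T ∈ distTriang (DCat A))
    (h₀ : Epi (τ.app (T.obj₃⟦(-1 : ℤ)⟧))) (h₁ : Mono (τ.app T.obj₁))
    (h₃ : Mono (τ.app T.obj₃)) : Mono (τ.app T.obj₂) := by
  rw [ModuleCat.epi_iff_surjective] at h₀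
  rw [ModuleCat.mono_iff_injective] at h₁ h₃ ⊢
  have hT' := Pretriangulated.inv_rot_of_distTriang _ hT
  refine (injective_iff_map_eq_zero (τ.app T.obj₂).hom).2 fun x hx ↦ ?_
  obtain ⟨v, rfl⟩ := exists_map_mor₁_apply_eq F hT x (h₃ (by
    refine (naturality_apply τ _ _).trans (Eq.trans ?_ (map_zero _).symm)
    exact (congrArg (G.map T.mor₂).hom hx).trans (map_zero _)))
  obtain ⟨w, hw⟩ := exists_map_mor₁_apply_eq G hT' ((τ.app T.obj₁).hom v)
    ((naturality_apply τ _ _).symm.trans hx)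
  obtain ⟨u, rfl⟩ := h₀ w
  obtain rfl : (F.map T.invRotate.mor₁).hom u = v :=
    h₁ ((naturality_apply τ _ _).trans hw)
  exact map_mor₂_mor₁_apply F hT' u

/-- Complexes with finitely generated cohomology concentrated in degree `n`. -/
def fgHeart (A : Type u) [CommRing A] [HasDerivedCategory.{w} (ModuleCat.{u} A)] (n : ℤ) :
    ObjectProperty (DCat A) :=
  fun X ↦ Dbf A X ∧ X.IsGE n ∧ X.IsLE n

lemma fgHeart_shift {n : ℤ} {X : DCat A} (h : fgHeart A n X) (a m : ℤ) (hm : a + m = n) :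
    fgHeart A m (X⟦a⟧) := by
  obtain ⟨h₁, _, _⟩ := h
  exact ⟨(Dbf A).le_shift a _ h₁, DerivedCategory.TStructure.t.isGE_shift X n a m hm,
    DerivedCategory.TStructure.t.isLE_shift X n a m hm⟩

/-- Dévissage along the canonical truncations. -/
lemma Dbf_devissage [IsNoetherianRing A] (P : ObjectProperty (DCat A))
    [P.IsClosedUnderIsomorphisms]
    [P.IsTriangulatedClosed₂] (a : ℤ) (hP : ∀ n, a ≤ n → fgHeart A n ≤ P) (Y : DCat A)
    (hY : Dbf A Y) (ha : Y.IsGE a) : P Y := by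
  obtain ⟨b, hb⟩ : ∃ b, Y.IsLE b := by
    obtain ⟨⟨_, b, h⟩, _⟩ := hY
    exact ⟨b, (DerivedCategory.isLE_iff _ _).2 fun i hi ↦ h i (Or.inr hi)⟩
  -- Induction on the length of the interval `[a, a + N]` containing the cohomology. Letting `a`
  -- vary keeps `hP` restricted to degrees `≥ a`, which `isLE_rHom_obj` relies on.
  obtain ⟨N, hN⟩ : ∃ N : ℕ, b ≤ a + N := ⟨(b - a).toNat, by lia⟩
  have hb' : Y.IsLE (a + N) := DerivedCategory.TStructure.t.isLE_of_le Y b _ hN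
  clear hb hN b
  induction N generalizing a Y with
  | zero => exact hP a le_rfl _ ⟨hY, ha, by simpa using hb'⟩
  | succ N ih =>
    obtain ⟨X, Z, hX, hZ, f, g, h, hT⟩ :=
      DerivedCategory.TStructure.t.exists_triangle Y a (a + 1) rfl
    have hX' := fun i ↦ (DerivedCategory.isLE_iff _ _).1 ⟨hX⟩ i
    have hZ' := fun i ↦ (DerivedCategory.isGE_iff _ _).1 ⟨hZ⟩ i
    have hY₁ := fun i ↦ (DerivedCategory.isGE_iff _ _).1 ha i
    have hY₂ := fun i ↦ (DerivedCategory.isLE_iff _ _).1 hb' i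
    -- By the long exact sequence, `H^i X` embeds in `H^i Y` for `i ≤ a`, and `H^i Z` is a quotient
    -- of `H^i Y` for `i ≥ a`. Finiteness thus passes to both truncations, to `X` by noetherianity.
    have mX (i : ℤ) (hi : i ≤ a) : Mono ((DerivedCategory.homologyFunctor _ i).map f) :=
      (DerivedCategory.HomologySequence.mono_homologyMap_mor₁_iff _ hT (i - 1) i (by lia)).2
        ((hZ' _ (by lia)).eq_of_src _ _)
    have eZ (i : ℤ) (hi : a ≤ i) : Epi ((DerivedCategory.homologyFunctor _ i).map g) :=
      (DerivedCategory.HomologySequence.epi_homologyMap_mor₂_iff _ hT i (i + 1) (by lia)).2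
        ((hX' _ (by lia)).eq_of_tgt _ _)
    have fX (i : ℤ) : Module.Finite A (cohomology i X) := by
      by_cases hi : i ≤ a
      · have := hY.2 i
        have := mX i hi
        exact Module.Finite.of_injective _ ((ModuleCat.mono_iff_injective _).1 this)
      · have := ModuleCat.subsingleton_of_isZero (hX' i (by lia))
        infer_instance
    have fZ (i : ℤ) : Module.Finite A (cohomology i Z) := by
      by_cases hi : a ≤ i
      · have := hY.2 i
        have := eZ i hi
        exact Module.Finite.of_surjective _ ((ModuleCat.epi_iff_surjective _).1 this)
      · have := ModuleCat.subsingleton_of_isZero (hZ' i (by lia))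
        infer_instance
    have zX (i : ℤ) (hi : i < a) : IsZero (cohomology i X) :=
      have := mX i hi.le
      (hY₁ i hi).of_mono ((DerivedCategory.homologyFunctor _ i).map f)
    have zZ (i : ℤ) (hi : a + (N + 1 : ℕ) < i) : IsZero (cohomology i Z) :=
      have := eZ i (by lia)
      (hY₂ i hi).of_epi ((DerivedCategory.homologyFunctor _ i).map g)
    refine P.ext_of_isTriangulatedClosed₂ _ hT (hP a le_rfl _ ⟨⟨⟨a, a, fun i hi ↦ ?_⟩, fX⟩, ?_, ?_⟩)
      (ih (a + 1) (fun n hn ↦ hP n (by lia)) _ ⟨⟨a, a + (N + 1 : ℕ), fun i hi ↦ ?_⟩, fZ⟩ ⟨hZ⟩ ?_)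
    · exact hi.elim (zX i) (hX' i)
    · exact (DerivedCategory.isGE_iff _ _).2 zX
    · exact ⟨hX⟩
    · exact hi.elim (fun h ↦ hZ' i (by lia)) (zZ i)
    · exact (DerivedCategory.isLE_iff _ _).2 fun i hi ↦ zZ i (by lia)

end

/-! ### Finitely generated modules and free presentations -/

section

variable {A : Type u} [CommRing A]

/-- Positive rank lets `prop_single₀_fin` start its induction at `A`, without assuming that the
property holds for the zero object. -/
lemma exists_surjective_fin_succ (M : Type u) [AddCommGroup M] [Module A M] [Module.Finite A M] :
    ∃ (m : ℕ) (f : (Fin (m + 1) → A) →ₗ[A] M), Function.Surjective f := by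
  obtain ⟨m, f, hf⟩ := Module.Finite.exists_fin' A M
  exact ⟨m, f ∘ₗ LinearMap.funLeft A A Fin.castSucc,
    hf.comp (LinearMap.funLeft_surjective_of_injective A A _ (Fin.castSucc_injective m))⟩

variable [HasDerivedCategory.{w} (ModuleCat.{u} A)]

/-- A module, as an object of the derived category concentrated in degree `0`. -/
abbrev single₀ (M : Type u) [AddCommGroup M] [Module A M] : DCat A :=
  (DerivedCategory.singleFunctor (ModuleCat.{u} A) 0).obj (ModuleCat.of A M)

/-- A linear equivalence induces an isomorphism in the derived category. -/
def single₀Iso {M N : Type u} [AddCommGroup M] [Module A M] [AddCommGroup N] [Module A N]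
    (e : M ≃ₗ[A] N) : single₀ (A := A) M ≅ single₀ (A := A) N :=
  (DerivedCategory.singleFunctor (ModuleCat.{u} A) 0).mapIso e.toModuleIso

lemma exists_distinguished_prod (M N : Type u) [AddCommGroup M] [Module A M] [AddCommGroup N]
    [Module A N] : ∃ T ∈ distTriang (DCat A), T.obj₁ = single₀ (A := A) M ∧
      T.obj₂ = single₀ (A := A) (M × N) ∧ T.obj₃ = single₀ (A := A) N := by
  let S : ShortComplex (ModuleCat.{u} A) := ShortComplex.mk
    (ModuleCat.ofHom (LinearMap.inl A M N)) (ModuleCat.ofHom (LinearMap.snd A M N)) (by ext; simp)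
  have hS : S.ShortExact :=
    { exact := (ShortComplex.ShortExact.moduleCat_exact_iff_function_exact _).2 Function.Exact.inl_snd
      mono_f := (ModuleCat.mono_iff_injective _).2 LinearMap.inl_injective
      epi_g := (ModuleCat.epi_iff_surjective _).2 LinearMap.snd_surjective }
  exact ⟨_, hS.singleTriangle_distinguished, rfl, rfl, rfl⟩

lemma exists_distinguished_ker {M N : Type u} [AddCommGroup M] [Module A M] [AddCommGroup N]
    [Module A N] (f : M →ₗ[A] N) (hf : Function.Surjective f) :
    ∃ T ∈ distTriang (DCat A), T.obj₁ = single₀ (A := A) (LinearMap.ker f) ∧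
      T.obj₂ = single₀ (A := A) M ∧ T.obj₃ = single₀ (A := A) N :=
  ⟨_, (LinearMap.shortExact_shortComplexKer hf).singleTriangle_distinguished, rfl, rfl, rfl⟩

lemma prop_single₀_fin (P : ObjectProperty (DCat A)) [P.IsClosedUnderIsomorphisms]
    [P.IsTriangulatedClosed₂] (hP : P (single₀ A)) (m : ℕ) :
    P (single₀ (A := A) (Fin (m + 1) → A)) := by
  induction m with
  | zero => exact P.prop_of_iso (single₀Iso (LinearEquiv.funUnique (Fin 1) A A)).symm hP
  | succ m ih =>
    obtain ⟨T, hT, h₁, h₂, h₃⟩ := exists_distinguished_prod (A := A) A (Fin (m + 1) → A)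
    refine P.prop_of_iso (single₀Iso (Fin.consLinearEquiv A fun _ : Fin (m + 2) ↦ A)) ?_
    rw [← h₂]
    exact P.ext_of_isTriangulatedClosed₂ _ hT (h₁ ▸ hP) (h₃ ▸ ih)

lemma fgHeart_single₀ (M : Type u) [AddCommGroup M] [Module A M] [Module.Finite A M] :
    fgHeart A 0 (single₀ (A := A) M) := by
  have h₁ := fun i hi ↦ DerivedCategory.isZero_of_isGE (single₀ (A := A) M) 0 i hi
  have h₂ := fun i hi ↦ DerivedCategory.isZero_of_isLE (single₀ (A := A) M) 0 i hi
  refine ⟨⟨⟨0, 0, fun i hi ↦ hi.elim (h₁ i) (h₂ i)⟩, fun i ↦ ?_⟩, inferInstance, inferInstance⟩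
  obtain hi | rfl | hi := lt_trichotomy i 0
  · have := ModuleCat.subsingleton_of_isZero (h₁ i hi)
    infer_instance
  · have : Module.Finite A ((𝟭 (ModuleCat.{u} A)).obj (ModuleCat.of A M)) := ‹_›
    exact Module.Finite.equiv ((DerivedCategory.singleFunctorCompHomologyFunctorIso
      (ModuleCat.{u} A) 0).app (ModuleCat.of A M)).symm.toLinearEquiv
  · have := ModuleCat.subsingleton_of_isZero (h₂ i hi)
    infer_instance

lemma exists_iso_single₀ {X : DCat A} (hX : fgHeart A 0 X) :
    ∃ (M : ModuleCat.{u} A) (_ : Module.Finite A M), Nonempty (single₀ (A := A) M ≅ X) := by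
  obtain ⟨h, h₁, h₂⟩ := hX
  obtain ⟨M, ⟨e⟩⟩ := X.exists_iso_singleFunctor_obj_of_isGE_of_isLE 0
  refine ⟨M, ?_, ⟨e.symm⟩⟩
  have := h.2 0
  exact Module.Finite.equiv ((DerivedCategory.homologyFunctor _ 0).mapIso e ≪≫
    (DerivedCategory.singleFunctorCompHomologyFunctorIso (ModuleCat.{u} A) 0).app M).toLinearEquiv

lemma exists_distinguished_of_iso_obj₃ {T : Pretriangulated.Triangle (DCat A)}
    (hT : T ∈ distTriang (DCat A)) {X : DCat A} (e : T.obj₃ ≅ X) :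
    ∃ T' ∈ distTriang (DCat A), T'.obj₁ = T.obj₁ ∧ T'.obj₂ = T.obj₂ ∧ T'.obj₃ = X :=
  ⟨.mk T.mor₁ (T.mor₂ ≫ e.hom) (e.inv ≫ T.mor₃),
    Pretriangulated.isomorphic_distinguished _ hT _
      (Pretriangulated.Triangle.isoMk _ _ (Iso.refl T.obj₁) (Iso.refl T.obj₂) e.symm
        ((Category.comp_id _).trans (Category.id_comp _).symm)
        (by change (T.mor₂ ≫ e.hom) ≫ e.inv = 𝟙 T.obj₂ ≫ T.mor₂; simp)
        (by change (e.inv ≫ T.mor₃) ≫ (𝟙 T.obj₁)⟦(1 : ℤ)⟧' = e.inv ≫ T.mor₃; simp)), rfl, rfl, rfl⟩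

/-- After shifting to degree `0` this is the exact sequence of a surjection from a free module,
whose kernel is finitely generated because `A` is noetherian. -/
lemma exists_presentation [IsNoetherianRing A] {n : ℤ} {X : DCat A} (hX : fgHeart A n X) :
    ∃ T ∈ distTriang (DCat A), fgHeart A n T.obj₁ ∧
      (∃ m : ℕ, T.obj₂ = (single₀ (A := A) (Fin (m + 1) → A))⟦-n⟧) ∧ T.obj₃ = X := by
  obtain ⟨M, _, ⟨e⟩⟩ := exists_iso_single₀ (fgHeart_shift hX n 0 (add_zero n))
  obtain ⟨m, f, hf⟩ := exists_surjective_fin_succ (A := A) M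
  obtain ⟨T, hT, h₁, h₂, h₃⟩ := exists_distinguished_ker f hf
  obtain ⟨T', hT', h₁', h₂', h₃'⟩ := exists_distinguished_of_iso_obj₃
    (Pretriangulated.Triangle.shift_distinguished T hT (-n))
    ((CategoryTheory.shiftFunctor (DCat A) (-n)).mapIso (eqToIso h₃ ≪≫ e) ≪≫
      (shiftEquiv (DCat A) n).unitIso.symm.app X)
  refine ⟨T', hT', ?_, ⟨m, ?_⟩, h₃'⟩
  · refine h₁' ▸ fgHeart_shift (n := 0) ?_ (-n) n (by lia)
    rw [h₁]
    exact fgHeart_single₀ _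
  · exact h₂'.trans (congrArg (fun Y : DCat A ↦ Y⟦-n⟧) h₂)

end

/-! ### Degree bounds and finiteness for `RHom(-, R)` -/

section

variable {A : Type u} [CommRing A]

variable [HasDerivedCategory.{w} (ModuleCat.{u} A)]

instance (R : DCat A) (hR : Db A R) : (RHom R hR).IsTriangulated :=
  derivedHom_isTriangulated _

section

variable {R : DCat A} {hR : Db A R}

lemma isGE_rHom_obj (M : DCat A) (a b : ℤ) (ha : R.IsGE a) (hb : M.IsLE b) :
    ((RHom R hR).obj (op M)).IsGE (a - b) :=
  have := DerivedCategory.TStructure.t.isGE_of_iso (kInjectiveResolution R hR).iso a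
  isGE_derivedHom_obj _ M a b

/-- `RHom_A(M⟦n⟧, R) ≅ RHom_A(M, R)⟦-n⟧`. -/
def rHomShiftIso (M : DCat A) (n : ℤ) :
    (RHom R hR).obj (op (M⟦n⟧)) ≅ ((RHom R hR).obj (op M))⟦-n⟧ :=
  (RHom R hR).mapIso ((Pretriangulated.shiftFunctorOpIso (DCat A) (-n) n (by lia)).symm.app
    (op M)) ≪≫ ((RHom R hR).commShiftIso (-n)).app (op M)

lemma isLE_rHom_obj_of_fgHeart {i₀ : ℤ} (h : ∀ (M : ModuleCat.{u} A) (i : ℤ), i₀ < i →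
      IsZero (cohomology i ((RHom R hR).obj (op (single₀ (A := A) M))))) {n : ℤ} {X : DCat A}
    (hX : fgHeart A n X) : ((RHom R hR).obj (op X)).IsLE (i₀ - n) := by
  obtain ⟨M, _, ⟨e⟩⟩ := exists_iso_single₀ (fgHeart_shift hX n 0 (add_zero n))
  have h₁ : ((RHom R hR).obj (op (single₀ (A := A) M))).IsLE i₀ :=
    (DerivedCategory.isLE_iff _ _).2 (h M)
  have h₂ := DerivedCategory.TStructure.t.isLE_of_iso ((RHom R hR).mapIso e.symm.op ≪≫
    rHomShiftIso X n) i₀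
  exact DerivedCategory.TStructure.t.isLE_of_shift _ (i₀ - n) (-n) i₀ (by lia)

lemma isTriangulatedClosed₂_unop_inverseImage (P : ObjectProperty (DCat A))
    [P.IsClosedUnderIsomorphisms] [P.IsTriangulatedClosed₂] (D : (DCat A)ᵒᵖ ⥤ DCat A)
    [D.CommShift ℤ] [D.IsTriangulated] : (P.inverseImage D).unop.IsTriangulatedClosed₂ :=
  .mk' fun T hT h₁ h₃ ↦ by
    obtain ⟨δ, h⟩ := exists_distinguished_of_contravariant D hT
    exact P.ext_of_isTriangulatedClosed₂ _ h h₃ h₁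

lemma finite_cohomology_obj₂ [IsNoetherianRing A] {T : Pretriangulated.Triangle (DCat A)}
    (hT : T ∈ distTriang (DCat A)) (i : ℤ) (h₁ : Module.Finite A (cohomology i T.obj₁))
    (h₃ : Module.Finite A (cohomology i T.obj₃)) : Module.Finite A (cohomology i T.obj₂) := by
  have := isNoetherian_of_range_eq_ker _ _
    (DerivedCategory.HomologySequence.exact₂ T hT i).moduleCat_range_eq_ker
  change Module.Finite A (cohomology i T.obj₂)
  infer_instance

lemma dbf_rHom_obj_single₀ (hRf : Dbf A R) : Dbf A ((RHom R hR).obj (op (single₀ A))) := by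
  obtain ⟨e⟩ := nonempty_rHom_single_iso R hR
  exact (Dbf A).prop_of_iso e.symm hRf

/-- This is dimension shifting for Ext with `i` fixed, the induction running over the degree `n` in
which `X` sits. Finite injective dimension plays no role. -/
lemma finite_cohomology_rHom_obj [IsNoetherianRing A] (hRf : Dbf A R) (i n : ℤ) (X : DCat A)
    (hX : fgHeart A n X) : Module.Finite A (cohomology i ((RHom R hR).obj (op X))) := by
  obtain ⟨r₀, _, hr⟩ := id hR
  have hr₀ : R.IsGE r₀ := (DerivedCategory.isGE_iff _ _).2 fun i hi ↦ hr i (Or.inl hi)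
  -- Here `RHom(X, R)` lives in degrees `≥ r₀ - n > i`, so its `H^i` is zero.
  have base (n : ℤ) (hn : n ≤ r₀ - i - 1) (X : DCat A) (hX : fgHeart A n X) :
      Module.Finite A (cohomology i ((RHom R hR).obj (op X))) := by
    have := isGE_rHom_obj (hR := hR) X r₀ n hr₀ hX.2.2
    have := ModuleCat.subsingleton_of_isZero (DerivedCategory.isZero_of_isGE
      ((RHom R hR).obj (op X)) (r₀ - n) i (by lia))
    infer_instance
  obtain hn | hn := le_total n (r₀ - i - 1)
  · exact base n hn X hX
  · induction n, hn using Int.leInduction generalizing X with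
    | base => exact base _ le_rfl X hX
    | succ n _ ih =>
      obtain ⟨T, hT, h₁, ⟨m, h₂⟩, rfl⟩ := exists_presentation hX
      -- Rotating puts `X` between the free object and the shifted kernel; the latter sits in degree
      -- `n`, where the induction hypothesis applies.
      obtain ⟨δ, h⟩ := exists_distinguished_of_contravariant (RHom R hR)
        (Pretriangulated.rot_of_distTriang _ hT)
      have f₁ := ih _ (fgHeart_shift h₁ 1 n (by lia))
      have := isTriangulatedClosed₂_unop_inverseImage (Dbf A) (RHom R hR)
      have f₂ : Dbf A ((RHom R hR).obj (op T.obj₂)) := by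
        have := prop_single₀_fin ((Dbf A).inverseImage (RHom R hR)).unop
          (dbf_rHom_obj_single₀ hRf) m
        rw [h₂]
        exact (Dbf A).prop_of_iso (rHomShiftIso _ _).symm ((Dbf A).le_shift _ _ this)
      exact finite_cohomology_obj₂ h i f₁ (f₂.2 i)

end

end

/-! ### Preservation of bounded finite cohomology, and reflexivity -/

section

variable {A : Type u} [CommRing A]

variable [HasDerivedCategory.{w} (ModuleCat.{u} A)]

variable {R : DCat A} {hR : Db A R}

lemma exists_isGE_of_Db {M : DCat A} (hM : Db A M) : ∃ a, M.IsGE a := by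
  obtain ⟨a, _, h⟩ := hM
  exact ⟨a, (DerivedCategory.isGE_iff _ _).2 fun i hi ↦ h i (Or.inl hi)⟩

lemma dbf_rHom_obj_of_fgHeart [IsNoetherianRing A] (hRf : Dbf A R)
    (h : HasFiniteInjectiveDimension R hR) (n : ℤ) (X : DCat A) (hX : fgHeart A n X) :
    Dbf A ((RHom R hR).obj (op X)) := by
  obtain ⟨i₀, h⟩ := h
  obtain ⟨r₀, hr₀⟩ := exists_isGE_of_Db hR
  have h₁ := isGE_rHom_obj (hR := hR) X r₀ n hr₀ hX.2.2
  have h₂ := isLE_rHom_obj_of_fgHeart h hX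
  exact ⟨⟨r₀ - n, i₀ - n, fun i hi ↦ hi.elim (fun h ↦ (DerivedCategory.isGE_iff _ _).1 h₁ i h)
    (fun h ↦ (DerivedCategory.isLE_iff _ _).1 h₂ i h)⟩,
    fun i ↦ finite_cohomology_rHom_obj hRf i n X hX⟩

lemma dbf_rHom_obj [IsNoetherianRing A] (hRf : Dbf A R)
    (h : HasFiniteInjectiveDimension R hR) (M : DCat A) (hM : Dbf A M) :
    Dbf A ((RHom R hR).obj (op M)) := by
  obtain ⟨a, ha⟩ := exists_isGE_of_Db hM.1
  have := isTriangulatedClosed₂_unop_inverseImage (Dbf A) (RHom R hR)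
  exact Dbf_devissage ((Dbf A).inverseImage (RHom R hR)).unop a
    (fun n _ X hX ↦ dbf_rHom_obj_of_fgHeart hRf h n X hX) M hM ha

/-- The pieces of `M` sit in degrees `n ≥ a` and have duals in degrees `≤ i₀ - n ≤ i₀ - a`, a bound
stable under extensions. -/
lemma isLE_rHom_obj [IsNoetherianRing A] {i₀ : ℤ} (h : ∀ (M : ModuleCat.{u} A) (i : ℤ), i₀ < i →
      IsZero (cohomology i ((RHom R hR).obj (op (single₀ (A := A) M))))) (M : DCat A)
    (hM : Dbf A M) (a : ℤ) (ha : M.IsGE a) : ((RHom R hR).obj (op M)).IsLE (i₀ - a) := by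
  have : (DerivedCategory.TStructure.t (C := ModuleCat.{u} A)).le (i₀ - a)
    |>.IsTriangulatedClosed₂ :=
      .mk' fun T hT h₁ h₃ ↦ (DerivedCategory.TStructure.t.isLE₂ T hT _ ⟨h₁⟩ ⟨h₃⟩).le
  have := isTriangulatedClosed₂_unop_inverseImage
    (DerivedCategory.TStructure.t.le (i₀ - a)) (RHom R hR)
  refine ⟨Dbf_devissage ((DerivedCategory.TStructure.t.le (i₀ - a)).inverseImage (RHom R hR)).unop
    a (fun n _ X hX ↦ ?_) M hM ha⟩
  have := isLE_rHom_obj_of_fgHeart h hX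
  exact (DerivedCategory.TStructure.t.isLE_of_le _ (i₀ - n) (i₀ - a)).le

/-- Only exactness at the middle term is at stake, so any connecting morphism completing the bidual
triangle will do. -/
lemma isHomological_bidual_homologyFunctor (D : (DCat A)ᵒᵖ ⥤ DCat A) [D.CommShift ℤ] [D.IsTriangulated]
    (k : ℤ) : ((D.rightOp ⋙ D) ⋙ DerivedCategory.homologyFunctor (ModuleCat.{u} A) k).IsHomological where
  exact T hT := by
    obtain ⟨δ, h⟩ := exists_distinguished_bidual D hT
    exact DerivedCategory.HomologySequence.exact₂ _ h k

/-- The morphism induced by the biduality morphism in cohomology. -/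
def cohomologyBiduality (R : DCat A) (hR : Db A R) (k : ℤ) :
    𝟭 _ ⋙ DerivedCategory.homologyFunctor (ModuleCat.{u} A) k ⟶
      ((RHom R hR).rightOp ⋙ RHom R hR) ⋙ DerivedCategory.homologyFunctor (ModuleCat.{u} A) k :=
  Functor.whiskerRight (biduality R hR) _

instance (k : ℤ) : (((RHom R hR).rightOp ⋙ RHom R hR) ⋙
    DerivedCategory.homologyFunctor (ModuleCat.{u} A) k).IsHomological :=
  isHomological_bidual_homologyFunctor _ k

instance (k : ℤ) : (𝟭 (DCat A) ⋙
    DerivedCategory.homologyFunctor (ModuleCat.{u} A) k).IsHomological :=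
  inferInstanceAs ((DerivedCategory.homologyFunctor (ModuleCat.{u} A) k).IsHomological)

/-- The objects for which the biduality morphism is an isomorphism. -/
def reflexive (R : DCat A) (hR : Db A R) : ObjectProperty (DCat A) :=
  fun M ↦ IsIso ((biduality R hR).app M)

instance : (reflexive R hR).IsClosedUnderIsomorphisms where
  of_iso e h := (NatTrans.isIso_app_iff_of_iso (biduality R hR) e).1 h

lemma reflexive_iff (M : DCat A) :
    reflexive R hR M ↔ ∀ k, IsIso ((cohomologyBiduality R hR k).app M) :=
  DerivedCategory.isIso_iff _ _

instance : (reflexive R hR).IsStableUnderShift ℤ where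
  isStableUnderShiftBy n := { le_shift := fun M hM ↦ isIso_derivedHomBiduality_app_shift _ M n hM }

lemma isIso_cohomologyBiduality_app {M : DCat A} (hM : reflexive R hR M) (k : ℤ) :
    IsIso ((cohomologyBiduality R hR k).app M) :=
  (reflexive_iff M).1 hM k

/-- The five lemma in each cohomological degree; shift stability of reflexive objects supplies the
two outer terms. -/
instance : (reflexive R hR).IsTriangulatedClosed₂ :=
  .mk' fun T hT h₁ h₃ ↦ by
    rw [reflexive_iff]
    intro k
    have i₁ := isIso_cohomologyBiduality_app h₁ k
    have i₃ := isIso_cohomologyBiduality_app h₃ k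
    have i₄ := isIso_cohomologyBiduality_app ((reflexive R hR).le_shift (1 : ℤ) _ h₁) k
    have i₀ := isIso_cohomologyBiduality_app ((reflexive R hR).le_shift (-1 : ℤ) _ h₃) k
    have := epi_app_obj₂ (cohomologyBiduality R hR k) hT inferInstance inferInstance inferInstance
    have := mono_app_obj₂ (cohomologyBiduality R hR k) hT inferInstance inferInstance inferInstance
    exact isIso_of_mono_of_epi _

/-- Source and target both vanish: `D X` lives in degrees `≥ r₀ - n`, hence `D D X` in degrees `≤ i₀
- (r₀ - n) < k`. -/
lemma isIso_cohomologyBiduality_of_lt [IsNoetherianRing A] (hRf : Dbf A R) {i₀ r₀ : ℤ}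
    (h : ∀ (M : ModuleCat.{u} A) (i : ℤ), i₀ < i →
      IsZero (cohomology i ((RHom R hR).obj (op (single₀ (A := A) M))))) (hr₀ : R.IsGE r₀)
    {n k : ℤ} (h₁ : n < k) (h₂ : i₀ - r₀ + n < k) {X : DCat A} (hX : fgHeart A n X) :
    IsIso ((cohomologyBiduality R hR k).app X) := by
  have h₃ := isLE_rHom_obj h _ (dbf_rHom_obj_of_fgHeart hRf ⟨i₀, h⟩ n X hX) (r₀ - n)
    (isGE_rHom_obj (hR := hR) X r₀ n hr₀ hX.2.2)
  exact isIso_of_source_target_iso_zero _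
    ((DerivedCategory.isLE_iff _ _).1 hX.2.2 k h₁).isoZero
    ((DerivedCategory.isLE_iff _ _).1 h₃ k (by lia)).isoZero

lemma reflexive_single₀_fin_shift (h : reflexive R hR (single₀ A)) (m : ℕ) (n : ℤ) :
    reflexive R hR ((single₀ (A := A) (Fin (m + 1) → A))⟦n⟧) :=
  (reflexive R hR).le_shift n _ (prop_single₀_fin _ h m)

lemma isIso_cohomologyBiduality_of_fgHeart [IsNoetherianRing A] (hRf : Dbf A R)
    (h : HasFiniteInjectiveDimension R hR) (hA : reflexive R hR (single₀ A)) (k n : ℤ)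
    (X : DCat A) (hX : fgHeart A n X) : IsIso ((cohomologyBiduality R hR k).app X) := by
  obtain ⟨i₀, h⟩ := h
  obtain ⟨r₀, hr₀⟩ := exists_isGE_of_Db hR
  have base (n : ℤ) (hn : n ≤ min k (k - i₀ + r₀) - 1) (X : DCat A) (hX : fgHeart A n X) :
      IsIso ((cohomologyBiduality R hR k).app X) :=
    isIso_cohomologyBiduality_of_lt hRf h hr₀ (by lia) (by lia) hX
  obtain hn | hn := le_total n (min k (k - i₀ + r₀) - 1)
  · exact base n hn X hX
  · induction n, hn using Int.leInduction generalizing X with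
    | base => exact base _ le_rfl X hX
    | succ n _ ih =>
      -- Surjectivity is proved for every object of degree `n + 1` at once, because injectivity for
      -- `X` uses it for another such object.
      have epi (X : DCat A) (hX : fgHeart A (n + 1) X) :
          Epi ((cohomologyBiduality R hR k).app X) := by
        obtain ⟨T, hT, h₁, ⟨m, h₂⟩, rfl⟩ := exists_presentation hX
        have r := h₂ ▸ reflexive_single₀_fin_shift hA m (-(n + 1))
        have i₁ := isIso_cohomologyBiduality_app r k
        have i₂ := isIso_cohomologyBiduality_app ((reflexive R hR).le_shift (1 : ℤ) _ r) k
        have i₃ := ih _ (fgHeart_shift h₁ 1 n (by lia))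
        exact epi_app_obj₂ (cohomologyBiduality R hR k) (Pretriangulated.rot_of_distTriang _ hT)
          (@IsIso.epi_of_iso _ _ _ _ _ i₁) (@IsIso.epi_of_iso _ _ _ _ _ i₃)
          (@IsIso.mono_of_iso _ _ _ _ _ i₂)
      have := epi X hX
      have : Mono ((cohomologyBiduality R hR k).app X) := by
        obtain ⟨T, hT, h₁, ⟨m, h₂⟩, rfl⟩ := exists_presentation hX
        have r := h₂ ▸ reflexive_single₀_fin_shift hA m (-(n + 1))
        have i₁ := isIso_cohomologyBiduality_app r k
        have i₃ := ih _ (fgHeart_shift h₁ 1 n (by lia))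
        -- The kernel of the presentation, shifted by `1` and back by `-1`, is again in degree `n +
        -- 1`, so the surjectivity just proved applies.
        have i₄ := epi _ (fgHeart_shift (fgHeart_shift h₁ 1 n (by lia)) (-1) (n + 1) (by lia))
        exact mono_app_obj₂ (cohomologyBiduality R hR k) (Pretriangulated.rot_of_distTriang _ hT)
          i₄ (@IsIso.mono_of_iso _ _ _ _ _ i₁) (@IsIso.mono_of_iso _ _ _ _ _ i₃)
      exact isIso_of_mono_of_epi _

lemma reflexive_of_dbf [IsNoetherianRing A] (hRf : Dbf A R)
    (h : HasFiniteInjectiveDimension R hR) (hA : reflexive R hR (single₀ A)) (M : DCat A)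
    (hM : Dbf A M) : reflexive R hR M := by
  obtain ⟨a, ha⟩ := exists_isGE_of_Db hM.1
  refine Dbf_devissage (reflexive R hR) a (fun n _ X hX ↦ (reflexive_iff X).2 fun k ↦ ?_) M hM ha
  exact isIso_cohomologyBiduality_of_fgHeart hRf h hA k n X hX

end

/-! ### The induced duality on the full subcategory -/

section

variable {A : Type u} [CommRing A]

variable [HasDerivedCategory.{w} (ModuleCat.{u} A)]

lemma dualityFunctor_isTriangulated [IsNoetherianRing A] (R : DCat A) (hR : Db A R)
    (h : ∀ M : DCat A, Dbf A M → Dbf A ((RHom R hR).obj (op M))) :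
    (dualityFunctor R hR h).IsTriangulated :=
  inferInstanceAs (((Dbf A).lift ((Dbf A).ι.op ⋙ RHom R hR) _).IsTriangulated)

lemma dualityFunctor_isEquivalence (R : DCat A) (hR : Db A R)
    (h : ∀ M : DCat A, Dbf A M → Dbf A ((RHom R hR).obj (op M)))
    (hθ : ∀ M : DCat A, Dbf A M → IsIso ((biduality R hR).app M)) :
    (dualityFunctor R hR h).IsEquivalence := by
  let F := dualityFunctor R hR h
  let e : 𝟭 (Dbf A).FullSubcategory ≅ F.rightOp ⋙ F :=
    NatIso.ofComponents (fun M ↦ (Dbf A).isoMk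
      (@asIso _ _ _ _ ((biduality R hR).app M.obj) (hθ _ M.property))) (fun {M N} f ↦
        ObjectProperty.hom_ext _ ((biduality R hR).naturality f.hom))
  -- The same isomorphism read in the opposite category makes `F.rightOp` a quasi-inverse; unit and
  -- counit need not satisfy a triangle identity beforehand.
  let e' : F ⋙ F.rightOp ≅ 𝟭 _ :=
    NatIso.ofComponents (fun M ↦ (e.app M.unop).op) (fun f ↦
      Quiver.Hom.unop_inj (e.hom.naturality f.unop).symm)
  exact (CategoryTheory.Equivalence.mk F F.rightOp e'.symm e.symm).isEquivalence_functor

lemma IsDualizing.isIso_biduality_app [IsNoetherianRing A] {R : DCat A} (hR : IsDualizing R)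
    (M : DCat A) (hM : Dbf A M) : IsIso ((biduality R hR.mem_Dbf.1).app M) :=
  reflexive_of_dbf hR.mem_Dbf hR.hasFiniteInjectiveDimension
    (isIso_biduality_app_single R _ hR.isIso_homothetyRHom) M hM

end

end

end DualizingComplex

theorem mainTheorem1 {A : Type u} [CommRing A] [IsNoetherianRing A]
    [HasDerivedCategory.{w} (ModuleCat.{u} A)] (R : DCat A) (hR : IsDualizing R) :
    (∀ M : DCat A, Dbf A M →
      Dbf A ((RHom R hR.mem_Dbf.1).obj (op M)) ∧ IsIso ((biduality R hR.mem_Dbf.1).app M)) ∧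
    ∃ h : ∀ M : DCat A, Dbf A M → Dbf A ((RHom R hR.mem_Dbf.1).obj (op M)),
      (dualityFunctor R hR.mem_Dbf.1 h).IsTriangulated ∧
      (dualityFunctor R hR.mem_Dbf.1 h).IsEquivalence := by
  have h := dbf_rHom_obj hR.mem_Dbf hR.hasFiniteInjectiveDimension
  exact ⟨fun M hM ↦ ⟨h M hM, hR.isIso_biduality_app M hM⟩, h,
    dualityFunctor_isTriangulated R _ h,
    dualityFunctor_isEquivalence R _ h hR.isIso_biduality_app⟩
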